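/- Let $\zeta$ be the Riemann zeta-function. Call $\gamma>0$ an ordinate if $\zeta$ has a zero with imaginary part $\gamma$. For $T>0$ that is not an ordinate, let $N(T)$ be the number of zeros $\beta+i\gamma$ of $\zeta$ with $0<\gamma\le T$, counted with multiplicity, and let $S(T)$ be the value of $\pi^{-1}\arg\zeta(\tfrac12+iT)$ obtained by continuous variation along the straight lines joining $2$, $2+iT$ and $\tfrac12+iT$, starting with the value $0$ at $2$. If $T>0$ is an ordinate, let $N(T)=\lim_{\delta\to0}\tfrac12[N(T-\delta)+N(T+\delta)]$ and $S(T)=\lim_{\delta\to0}\tfrac12[S(T-\delta)+S(T+\delta)]$. Put $$L(T)=\frac{T}{2\pi}\left(\log\frac{T}{2\pi}-1\right)+\frac78,\qquad Q(T)=N(T)-L(T).$$ Then for all $t\ge 2\pi$ these quantities are well defined (if $t$ is an ordinate, the two limits exist), and $$|Q(t)-S(t)|\le\frac{1}{150\,t}.$$ -/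

import Mathlib

noncomputable section

namespace ZetaCount

open Filter Topology

/-- The set of positive ordinates of zeros of `ζ`. -/
def ordinates : Set ℝ := {γ | 0 < γ ∧ ∃ ρ : ℂ, riemannZeta ρ = 0 ∧ ρ.im = γ}

/-- The set of zeros `ρ = β + iγ` of `ζ` with `0 < γ ≤ T`. -/
def zerosUpTo (T : ℝ) : Set ℂ := {ρ | riemannZeta ρ = 0 ∧ 0 < ρ.im ∧ ρ.im ≤ T}

/-- The number of zeros `ρ = β + iγ` of `ζ` with `0 < γ ≤ T`, counted with multiplicity. -/
def zeroCount (T : ℝ) : ℕ := ∑ᶠ ρ ∈ zerosUpTo T, analyticOrderNatAt riemannZeta ρ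

/-- `a` is the value at `1/2 + iT` of the argument of `ζ` obtained by continuous variation along
the straight lines joining `2`, `2 + iT` and `1/2 + iT`, starting with the value `0` at `2`:
`f` is the argument on the vertical segment and `g` the argument on the horizontal one. -/
def IsZetaArg (T a : ℝ) : Prop :=
  ∃ f g : ℝ → ℝ,
    ContinuousOn f (Set.Icc 0 T) ∧ ContinuousOn g (Set.Icc (1 / 2) 2) ∧
    (∀ y ∈ Set.Icc (0 : ℝ) T, riemannZeta (2 + y * Complex.I) =
      ‖riemannZeta (2 + y * Complex.I)‖ * Complex.exp (f y * Complex.I)) ∧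
    (∀ x ∈ Set.Icc (1 / 2 : ℝ) 2, riemannZeta (x + T * Complex.I) =
      ‖riemannZeta (x + T * Complex.I)‖ * Complex.exp (g x * Complex.I)) ∧
    f 0 = 0 ∧ g 2 = f T ∧ g (1 / 2) = a

/-- The argument of `ζ(1/2 + iT)` by continuous variation; see `existsUnique_isZetaArg`. -/
def zetaArg (T : ℝ) : ℝ := Classical.epsilon (IsZetaArg T)

/-- The mean of the values of `u` at `T - δ` and `T + δ`. -/
def symmMean (u : ℝ → ℝ) (T δ : ℝ) : ℝ := (u (T - δ) + u (T + δ)) / 2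

/-- `N(T)` where `T` is not an ordinate. -/
def N₀ (T : ℝ) : ℝ := zeroCount T

/-- `S(T) = π⁻¹ arg ζ(1/2 + iT)` where `T` is not an ordinate. -/
def S₀ (T : ℝ) : ℝ := Real.pi⁻¹ * zetaArg T

open Classical in
/-- `N(T)` for `T > 0`: the number of zeros of `ζ` with `0 < γ ≤ T` if `T` is not an ordinate,
and `lim_{δ → 0} [N(T - δ) + N(T + δ)] / 2` if it is. -/
def N (T : ℝ) : ℝ :=
  if T ∈ ordinates then limUnder (𝓝[≠] 0) (symmMean N₀ T) else N₀ T

open Classical in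
/-- `S(T)` for `T > 0`: `π⁻¹ arg ζ(1/2 + iT)` if `T` is not an ordinate,
and `lim_{δ → 0} [S(T - δ) + S(T + δ)] / 2` if it is. -/
def S (T : ℝ) : ℝ :=
  if T ∈ ordinates then limUnder (𝓝[≠] 0) (symmMean S₀ T) else S₀ T

/-- `L(T) = (T / 2π) (log (T / 2π) - 1) + 7/8`. -/
def L (T : ℝ) : ℝ :=
  T / (2 * Real.pi) * (Real.log (T / (2 * Real.pi)) - 1) + 7 / 8

/-- `Q(T) = N(T) - L(T)`. -/
def Q (T : ℝ) : ℝ := N T - L T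

/-! Well-definedness of the zero count and of the argument. -/

theorem re_mem_of_zero {ρ : ℂ} (h : riemannZeta ρ = 0) (him : ρ.im ≠ 0) :
    0 < ρ.re ∧ ρ.re < 1 := by
  refine ⟨?_, ?_⟩
  · by_contra! hre
    have h1 : riemannZeta (1 - ρ) ≠ 0 :=
      riemannZeta_ne_zero_of_one_le_re (by simp; linarith)
    have hs : ∀ n : ℕ, (1 - ρ) ≠ -n := fun n hn => him (by
      have := congrArg Complex.im hn
      simpa using this)
    have hs' : (1 - ρ) ≠ 1 := fun hn => him (by
      have := congrArg Complex.im hn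
      simpa using this)
    have key := riemannZeta_one_sub hs hs'
    rw [sub_sub_cancel, h] at key
    have hcos : Complex.cos (Real.pi * (1 - ρ) / 2) ≠ 0 := by
      rw [Complex.cos_ne_zero_iff]
      intro k hk
      have := congrArg Complex.im hk
      have e : (2 * (k : ℂ) + 1) * Real.pi / 2 = (((2 * (k : ℝ) + 1) * Real.pi / 2 : ℝ) : ℂ) := by
        push_cast; ring
      rw [e, Complex.ofReal_im] at this
      have e2 : (Real.pi : ℂ) * (1 - ρ) / 2 = ((Real.pi / 2 : ℝ) : ℂ) * (1 - ρ) := by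
        push_cast; ring
      rw [e2, Complex.im_ofReal_mul] at this
      simp [him, Real.pi_ne_zero] at this
    have hg : Complex.Gamma (1 - ρ) ≠ 0 := Complex.Gamma_ne_zero hs
    have hp : (2 * (Real.pi : ℂ)) ^ (-(1 - ρ)) ≠ 0 := by
      rw [Complex.cpow_ne_zero_iff]
      left; simp [Real.pi_ne_zero]
    exact (mul_ne_zero (mul_ne_zero (mul_ne_zero (mul_ne_zero two_ne_zero hp) hg) hcos) h1) key.symm
  · by_contra! hre
    exact riemannZeta_ne_zero_of_one_le_re hre h

/-- The count `zeroCount T` is a finite sum. -/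
theorem zerosUpTo_finite (T : ℝ) : (zerosUpTo T).Finite := by
  have hc : IsCompact (Set.Icc (0 : ℝ) 1 ×ℂ Set.Icc (0 : ℝ) T) :=
    isCompact_Icc.reProdIm isCompact_Icc
  refine (hc.inter_riemannZetaZeros_finite).subset ?_
  rintro ρ ⟨h0, hpos, hle⟩
  have := re_mem_of_zero h0 hpos.ne'
  exact ⟨⟨⟨this.1.le, this.2.le⟩, ⟨hpos.le, hle⟩⟩, h0⟩

/-- A continuous argument with prescribed initial value exists along a segment
on which a continuous function does not vanish. -/
theorem exists_arg {a b c : ℝ} (hab : a ≤ b) (hc : c ∈ Set.Icc a b) {F : ℝ → ℂ}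
    (hF : ContinuousOn F (Set.Icc a b)) (h0 : ∀ x ∈ Set.Icc a b, F x ≠ 0) {α : ℝ}
    (hα : F c = ‖F c‖ * Complex.exp (α * Complex.I)) :
    ∃ f : ℝ → ℝ, ContinuousOn f (Set.Icc a b) ∧ f c = α ∧
      ∀ x ∈ Set.Icc a b, F x = ‖F x‖ * Complex.exp (f x * Complex.I) := by
  let G : ℝ → ℂ := Set.IccExtend hab ((Set.Icc a b).domRestrict F)
  have hG : Continuous G := (continuousOn_iff_continuous_domRestrict.mp hF).Icc_extend'
  have hGF : ∀ x ∈ Set.Icc a b, G x = F x := fun x hx => by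
    simp [G, Set.IccExtend_of_mem, hx]
  have hG0 : (0 : ℂ) ∉ G '' Set.univ := by
    rintro ⟨x, -, hx⟩
    exact h0 _ (Set.projIcc a b hab x).2 hx
  have hsc : IsSimplyConnected (Set.univ : Set ℝ) := by
    have : ContractibleSpace (Set.univ : Set ℝ) :=
      (convex_univ (𝕜 := ℝ)).contractibleSpace Set.univ_nonempty
    exact (inferInstance : SimplyConnectedSpace (Set.univ : Set ℝ))
  obtain ⟨l, hl, hle⟩ := Complex.exists_continuousOn_eqOn_exp_comp
    (U := (Set.univ : Set ℝ)) hsc isOpen_univ hG.continuousOn hG0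
  have hlF : ∀ x ∈ Set.Icc a b, F x = ‖F x‖ * Complex.exp ((l x).im * Complex.I) := by
    intro x hx
    have e : Complex.exp (l x) = F x := by rw [← hGF x hx]; exact hle (Set.mem_univ x)
    rw [← e, Complex.norm_exp, Complex.ofReal_exp, ← Complex.exp_add, Complex.re_add_im]
  have hn : (‖F c‖ : ℂ) ≠ 0 := by simpa using h0 c hc
  have hk : Complex.exp (((l c).im - α : ℝ) * Complex.I) = 1 := by
    have := (hlF c hc).symm.trans hα
    have := mul_left_cancel₀ hn this
    push_cast
    rw [sub_mul, Complex.exp_sub, this, div_self (Complex.exp_ne_zero _)]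
  refine ⟨fun x => (l x).im - ((l c).im - α), ?_, by ring, fun x hx => ?_⟩
  · exact ((Complex.continuous_im.comp_continuousOn hl).mono (Set.subset_univ _)).sub
      continuousOn_const
  · conv_lhs => rw [hlF x hx]
    rw [Complex.ofReal_sub, sub_mul (_ : ℂ), Complex.exp_sub, hk, div_one]

/-- Two continuous arguments along a segment which agree at a point agree. -/
theorem arg_unique {a b c : ℝ} (hc : c ∈ Set.Icc a b) {F : ℝ → ℂ}
    (h0 : ∀ x ∈ Set.Icc a b, F x ≠ 0) {f g : ℝ → ℝ}
    (hf : ContinuousOn f (Set.Icc a b)) (hg : ContinuousOn g (Set.Icc a b))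
    (hfF : ∀ x ∈ Set.Icc a b, F x = ‖F x‖ * Complex.exp (f x * Complex.I))
    (hgF : ∀ x ∈ Set.Icc a b, F x = ‖F x‖ * Complex.exp (g x * Complex.I))
    (hfg : f c = g c) : ∀ x ∈ Set.Icc a b, f x = g x := by
  have hint : ∀ x ∈ Set.Icc a b, ∃ n : ℤ, (f x - g x) / (2 * Real.pi) = n := by
    intro x hx
    have hn : (‖F x‖ : ℂ) ≠ 0 := by simpa using h0 x hx
    have := mul_left_cancel₀ hn ((hfF x hx).symm.trans (hgF x hx))
    obtain ⟨n, hn⟩ := Complex.exp_eq_exp_iff_exists_int.mp this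
    refine ⟨n, ?_⟩
    have h2 := congrArg Complex.im hn
    simp at h2
    rw [h2]
    field_simp
    ring
  have hcont : ContinuousOn (fun x => (f x - g x) / (2 * Real.pi)) (Set.Icc a b) :=
    (hf.sub hg).div_const _
  intro x hx
  have := isPreconnected_Icc.constant_of_mapsTo (T := Set.range ((↑) : ℤ → ℝ))
    Int.isClosedEmbedding_coe_real.toIsEmbedding.isDiscrete_range hcont
    (fun y hy => (hint y hy).imp fun n hn => hn.symm) hx hc
  simp only [hfg, sub_self, zero_div, div_eq_zero_iff] at this
  rcases this with h | h
  · linarith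
  · exact absurd h (by positivity)

/-- The argument of `ζ(1/2 + iT)` by continuous variation exists and is unique
if `T > 0` is not an ordinate. -/
theorem existsUnique_isZetaArg {T : ℝ} (hT : 0 < T) (hT' : T ∉ ordinates) :
    ∃! a, IsZetaArg T a := by
  have hv0 : ∀ y ∈ Set.Icc (0 : ℝ) T, riemannZeta (2 + y * Complex.I) ≠ 0 := fun y _ =>
    riemannZeta_ne_zero_of_one_le_re (by simp)
  have hh0 : ∀ x ∈ Set.Icc (1 / 2 : ℝ) 2, riemannZeta (x + T * Complex.I) ≠ 0 := fun x _ h =>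
    hT' ⟨hT, _, h, by simp⟩
  have hvc : ContinuousOn (fun y : ℝ => riemannZeta (2 + y * Complex.I)) (Set.Icc 0 T) := by
    intro y _
    refine ContinuousAt.continuousWithinAt ?_
    refine ContinuousAt.comp (f := fun y : ℝ => (2 + y * Complex.I : ℂ))
      (differentiableAt_riemannZeta fun h => ?_).continuousAt (by fun_prop)
    have := congrArg Complex.re h
    norm_num at this
  have hhc : ContinuousOn (fun x : ℝ => riemannZeta (x + T * Complex.I))
      (Set.Icc (1 / 2) 2) := by
    intro y _
    refine ContinuousAt.continuousWithinAt ?_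
    refine ContinuousAt.comp (f := fun x : ℝ => (x + T * Complex.I : ℂ))
      (differentiableAt_riemannZeta fun h => ?_).continuousAt (by fun_prop)
    have := congrArg Complex.im h
    simp [hT.ne'] at this
  have h2 : riemannZeta (2 + (0 : ℝ) * Complex.I) =
      ‖riemannZeta (2 + (0 : ℝ) * Complex.I)‖ * Complex.exp ((0 : ℝ) * Complex.I) := by
    have e : riemannZeta 2 = ((Real.pi ^ 2 / 6 : ℝ) : ℂ) := by
      rw [riemannZeta_two]; push_cast; ring
    simp only [Complex.ofReal_zero, zero_mul, add_zero, Complex.exp_zero, mul_one]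
    rw [e, Complex.norm_of_nonneg (by positivity)]
  have m0 : (0 : ℝ) ∈ Set.Icc 0 T := ⟨le_rfl, hT.le⟩
  have mT : T ∈ Set.Icc 0 T := ⟨hT.le, le_rfl⟩
  have m2 : (2 : ℝ) ∈ Set.Icc (1 / 2 : ℝ) 2 := by norm_num
  have mh : (1 / 2 : ℝ) ∈ Set.Icc (1 / 2 : ℝ) 2 := by norm_num
  obtain ⟨f, hf, f0, hfF⟩ := exists_arg hT.le m0 hvc hv0 h2
  obtain ⟨g, hg, g2, hgF⟩ := exists_arg (by norm_num) m2 hhc hh0 (α := f T)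
    (by simpa using hfF T mT)
  refine ⟨g (1 / 2), ⟨f, g, hf, hg, hfF, hgF, f0, g2, rfl⟩, ?_⟩
  rintro _ ⟨f', g', hf', hg', hfF', hgF', f0', g2', rfl⟩
  have e1 := arg_unique m0 hv0 hf' hf hfF' hfF (f0'.trans f0.symm) T mT
  exact arg_unique m2 hh0 hg' hg hgF' hgF (by rw [g2', g2, e1]) _ mh

theorem isZetaArg_zetaArg {T : ℝ} (hT : 0 < T) (hT' : T ∉ ordinates) :
    IsZetaArg T (zetaArg T) :=
  Classical.epsilon_spec (existsUnique_isZetaArg hT hT').exists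

end ZetaCount

end

namespace ZetaCount

open Filter Topology

/-! Let ϑ(T) be the continuous argument of Γ(1/4 + iT/2) minus (T/2) log π. The Riemann–von Mangoldt
formula N(T) = 1 + ϑ(T)/π + S(T) reduces the claim to a bound for 1 + ϑ/π − L, which concerns Γ
alone. Since 1 + ϑ/π is continuous, the means at an ordinate lead to the same bound.

The formula (`zetaArg_eq`) needs neither a contour integral nor an infinite product. In a strip |im|
< R, ξ is a polynomial formed from its zeros there, times an entire function h without zeros in the
strip (`exists_xi_factor`). The symmetries of ξ force h⁴ > 0 on the real axis and on the critical
line, so h has the same argument at 2 and at 1/2 + iT. The arguments of the linear factors cancel at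
2 (`sum_arg_two_sub`) and add up to πN(T) at 1/2 + iT (`sum_arg_half`). The factors s(s − 1),
π^(−s/2) and Γ(s/2) supply the rest.

For Γ, duplication and reflection express the argument at 1/4 + iT/2 through the one at 1/2 + iT, up
to an exponentially small term (`two_mul_arg_Gamma_quarter`). On the critical line Stirling's
formula comes from telescoping a corrected midpoint rule for log (`abs_gammaArg_sub_le`). What is
left is 1/(48πT) + O(T⁻³), and 1/(48π) lies just below 1/150. -/

/-! ### Stirling's formula for the argument of Γ on the critical line. -/

/-- The main terms `w log w - w - 1 / (24 w)` of the expansion of `log Γ(w + 1/2)`. -/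
noncomputable def gammaPhase (w : ℂ) : ℂ := w * Complex.log w - w - 1 / (24 * w)

theorem norm_le_norm_add_ofReal {w : ℂ} (hre : 0 ≤ w.re) {r : ℝ} (hr : 0 ≤ r) :
    ‖w‖ ≤ ‖w + r‖ := by
  rw [← sq_le_sq₀ (norm_nonneg _) (norm_nonneg _), Complex.sq_norm, Complex.sq_norm,
    Complex.normSq_apply, Complex.normSq_apply]
  simp only [Complex.add_re, Complex.ofReal_re, Complex.add_im, Complex.ofReal_im, add_zero]
  nlinarith [mul_nonneg hre hr]

theorem add_ofReal_mem_slitPlane {w : ℂ} (hw : w ∈ Complex.slitPlane) {r : ℝ}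
    (hr : 0 ≤ r) : w + r ∈ Complex.slitPlane := by
  rw [Complex.mem_slitPlane_iff] at hw ⊢
  simp only [Complex.add_re, Complex.ofReal_re, Complex.add_im, Complex.ofReal_im, add_zero]
  rcases hw with h | h
  · left; linarith
  · right; exact h

/-- The midpoint rule for the logarithm with its first correction. -/
theorem norm_gammaPhase_step_le {w : ℂ} (hre : 0 ≤ w.re) (hw : w ∈ Complex.slitPlane) :
    ‖gammaPhase (w + 1) - gammaPhase w - Complex.log (w + 1 / 2)‖ ≤ 7 / 960 / ‖w‖ ^ 4 := by
  have hw0 : w ≠ 0 := Complex.slitPlane_ne_zero hw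
  have hn : 0 < ‖w‖ := norm_pos_iff.mpr hw0
  have hslit : ∀ r : ℝ, 0 ≤ r → w + r ∈ Complex.slitPlane :=
    fun r hr => add_ofReal_mem_slitPlane hw hr
  have hne : ∀ r : ℝ, 0 ≤ r → w + r ≠ 0 := fun r hr => Complex.slitPlane_ne_zero (hslit r hr)
  have hge : ∀ r : ℝ, 0 ≤ r → ‖w‖ ≤ ‖w + r‖ := fun r hr => norm_le_norm_add_ofReal hre hr
  set v : ℂ := w + 1 / 2 with hv
  have hplus : ∀ h : ℝ, v + h = w + ((1 / 2 + h : ℝ) : ℂ) := fun h => by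
    rw [hv]; push_cast; ring
  have hminus : ∀ h : ℝ, v - h = w + ((1 / 2 - h : ℝ) : ℂ) := fun h => by
    rw [hv]; push_cast; ring
  have hw1 : w + 1 ≠ 0 := by simpa using hne 1 zero_le_one
  have hvslit : v ∈ Complex.slitPlane := by
    have := hslit (1 / 2) (by norm_num)
    push_cast at this
    exact this
  -- The Taylor correction of the midpoint rule is h³/(3v²). With c = w(w + 1) in place of v², its
  -- value at h = 1/2 is exactly 1/(24w) − 1/(24(w + 1)), which telescopes.
  set c : ℂ := v ^ 2 - 1 / 4 with hc
  have hcw : c = w * (w + 1) := by rw [hc, hv]; ring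
  have hc0 : c ≠ 0 := by rw [hcw]; exact mul_ne_zero hw0 hw1
  let e : ℝ → ℂ := fun h => (v + h) * Complex.log (v + h) - (v - h) * Complex.log (v - h) - 2 * h
    - 2 * h * Complex.log v + (h : ℂ) ^ 3 / (3 * c)
  let e' : ℝ → ℂ := fun h => Complex.log (v + h) + Complex.log (v - h) - 2 * Complex.log v
    + (h : ℂ) ^ 2 / c
  let e'' : ℝ → ℂ := fun h => 1 / (v + h) - 1 / (v - h) + 2 * h / c
  have hcast : ∀ h : ℝ, HasDerivAt (fun x : ℝ => (x : ℂ)) 1 h := fun h =>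
    Complex.ofRealCLM.hasDerivAt
  have hlp : ∀ h : ℝ, 0 ≤ h → h ≤ 1 / 2 →
      HasDerivAt (fun x : ℝ => Complex.log (v + x)) (1 / (v + h)) h := fun h h0 _ => by
    have := ((hcast h).const_add v).clog_real (by rw [hplus]; exact hslit _ (by linarith))
    simpa using this
  have hlm : ∀ h : ℝ, 0 ≤ h → h ≤ 1 / 2 →
      HasDerivAt (fun x : ℝ => Complex.log (v - x)) (-1 / (v - h)) h := fun h _ h1 => by
    have := ((hcast h).const_sub v).clog_real (by rw [hminus]; exact hslit _ (by linarith))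
    simpa using this
  have he : ∀ h : ℝ, 0 ≤ h → h ≤ 1 / 2 → HasDerivAt e (e' h) h := fun h h0 h1 => by
    have n1 : v + h ≠ 0 := by rw [hplus]; exact hne _ (by linarith)
    have n2 : v - h ≠ 0 := by rw [hminus]; exact hne _ (by linarith)
    have d := ((((((hcast h).const_add v).mul (hlp h h0 h1)).sub
      (((hcast h).const_sub v).mul (hlm h h0 h1))).sub ((hcast h).const_mul 2)).sub
      (((hcast h).const_mul 2).mul_const (Complex.log v))).add
      (((hcast h).pow 3).div_const (3 * c))
    refine d.congr_deriv ?_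
    simp only [e']
    field_simp
    push_cast
    ring
  have he' : ∀ h : ℝ, 0 ≤ h → h ≤ 1 / 2 → HasDerivAt e' (e'' h) h := fun h h0 h1 => by
    have d := (((hlp h h0 h1).add (hlm h h0 h1)).sub_const (2 * Complex.log v)).add
      (((hcast h).pow 2).div_const c)
    refine d.congr_deriv ?_
    simp only [e'']
    push_cast
    ring
  -- The fractions in e'' combine to 2h(1/4 − h²)/((v² − h²)c). As e and e' vanish at 0, the bound
  -- is integrated twice to (h³/12 − h⁵/10)/‖w‖⁴, and h = 1/2 gives 7/960.
  have hb'' : ∀ h : ℝ, 0 ≤ h → h ≤ 1 / 2 → ‖e'' h‖ ≤ (h / 2 - 2 * h ^ 3) / ‖w‖ ^ 4 := by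
    intro h h0 h1
    have n1 : v + h ≠ 0 := by rw [hplus]; exact hne _ (by linarith)
    have n2 : v - h ≠ 0 := by rw [hminus]; exact hne _ (by linarith)
    have heq : e'' h = ((h / 2 - 2 * h ^ 3 : ℝ) : ℂ) / ((v + h) * (v - h) * (w * (w + 1))) := by
      simp only [e'']
      rw [← hcw]
      field_simp
      rw [hc]
      push_cast
      ring
    rw [heq, norm_div, Complex.norm_real, Real.norm_of_nonneg (by nlinarith [sq_nonneg h])]
    have hb : ‖w‖ ^ 4 ≤ ‖(v + h) * (v - h) * (w * (w + 1))‖ := by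
      rw [norm_mul, norm_mul, norm_mul]
      have b1 : ‖w‖ ≤ ‖v + h‖ := by rw [hplus]; exact hge _ (by linarith)
      have b2 : ‖w‖ ≤ ‖v - h‖ := by rw [hminus]; exact hge _ (by linarith)
      have b3 : ‖w‖ ≤ ‖w + 1‖ := by simpa using hge 1 zero_le_one
      calc ‖w‖ ^ 4 = ‖w‖ * ‖w‖ * (‖w‖ * ‖w‖) := by ring
        _ ≤ _ := by gcongr
    gcongr
    nlinarith [sq_nonneg h]
  have hb' : ∀ h ∈ Set.Icc (0 : ℝ) (1 / 2), ‖e' h‖ ≤ (h ^ 2 / 4 - h ^ 4 / 2) / ‖w‖ ^ 4 := by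
    refine image_norm_le_of_norm_deriv_right_le_deriv_boundary
      (B := fun h => (h ^ 2 / 4 - h ^ 4 / 2) / ‖w‖ ^ 4)
      (B' := fun h => (h / 2 - 2 * h ^ 3) / ‖w‖ ^ 4)
      (fun h hh => (he' h hh.1 hh.2).continuousAt.continuousWithinAt)
      (fun h hh => (he' h hh.1 hh.2.le).hasDerivWithinAt) ?_ ?_
      (fun h hh => hb'' h hh.1 hh.2.le)
    · simp [e', two_mul]
    · intro x
      have := ((((hasDerivAt_id x).pow 2).div_const 4).sub
        (((hasDerivAt_id x).pow 4).div_const 2)).div_const (‖w‖ ^ 4)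
      refine this.congr_deriv ?_
      simp
      ring
  have hb : ∀ h ∈ Set.Icc (0 : ℝ) (1 / 2), ‖e h‖ ≤ (h ^ 3 / 12 - h ^ 5 / 10) / ‖w‖ ^ 4 := by
    refine image_norm_le_of_norm_deriv_right_le_deriv_boundary
      (B := fun h => (h ^ 3 / 12 - h ^ 5 / 10) / ‖w‖ ^ 4)
      (B' := fun h => (h ^ 2 / 4 - h ^ 4 / 2) / ‖w‖ ^ 4)
      (fun h hh => (he h hh.1 hh.2).continuousAt.continuousWithinAt)
      (fun h hh => (he h hh.1 hh.2.le).hasDerivWithinAt) ?_ ?_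
      (fun h hh => hb' h ⟨hh.1, hh.2.le⟩)
    · simp [e]
    · intro x
      have := ((((hasDerivAt_id x).pow 3).div_const 12).sub
        (((hasDerivAt_id x).pow 5).div_const 10)).div_const (‖w‖ ^ 4)
      refine this.congr_deriv ?_
      simp
      ring
  have key := hb (1 / 2) ⟨by norm_num, le_rfl⟩
  have e1 : v + ((1 / 2 : ℝ) : ℂ) = w + 1 := by rw [hv]; push_cast; ring
  have e2 : v - ((1 / 2 : ℝ) : ℂ) = w := by rw [hv]; push_cast; ring
  have heq : gammaPhase (w + 1) - gammaPhase w - Complex.log v = e (1 / 2) := by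
    simp only [e, gammaPhase]
    rw [e1, e2, hcw]
    push_cast
    field_simp
    ring
  rw [heq]
  refine key.trans (le_of_eq ?_)
  norm_num

/-- The error of the midpoint rule for `log` on the segment from `w` to `w + 1`. -/
noncomputable def gammaStep (w : ℂ) : ℂ :=
  gammaPhase (w + 1) - gammaPhase w - Complex.log (w + 1 / 2)

/-- A continuous argument of `Γ` on the critical line. -/
noncomputable def gammaArg (T : ℝ) : ℝ :=
  (gammaPhase (1 + T * Complex.I)).im - (1 / 2 + T * Complex.I : ℂ).arg
    + ∑' k : ℕ, (gammaStep ((k + 1 : ℕ) + T * Complex.I)).im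

theorem sq_norm_natCast_add (k : ℕ) (T : ℝ) : ‖(k : ℂ) + T * Complex.I‖ ^ 2 = k ^ 2 + T ^ 2 := by
  rw [Complex.sq_norm, Complex.normSq_apply]
  simp
  ring

theorem norm_gammaStep_le (k : ℕ) {T : ℝ} (h : T ≠ 0 ∨ k ≠ 0) :
    ‖gammaStep (k + T * Complex.I)‖ ≤ 7 / 960 / ((k : ℝ) ^ 2 + T ^ 2) ^ 2 := by
  have := norm_gammaPhase_step_le (w := k + T * Complex.I) (by simp) (by
    rw [Complex.mem_slitPlane_iff]
    rcases h with h | h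
    · right; simpa using h
    · left; simpa using Nat.pos_of_ne_zero h)
  rwa [← sq_norm_natCast_add k T, ← pow_mul]

theorem abs_im_gammaStep_succ_le (k : ℕ) (T : ℝ) :
    |(gammaStep ((k + 1 : ℕ) + T * Complex.I)).im| ≤ 1 / ((k + 1 : ℕ) : ℝ) ^ 2 := by
  refine (Complex.abs_im_le_norm _).trans ((norm_gammaStep_le (k + 1) (.inr k.succ_ne_zero)).trans ?_)
  have h1 : (1 : ℝ) ≤ (k + 1 : ℕ) := by push_cast; linarith [k.cast_nonneg (α := ℝ)]
  set x : ℝ := ((k + 1 : ℕ) : ℝ)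
  rw [div_div, div_le_div_iff₀ (by positivity) (by positivity)]
  have h2 : 1 ≤ x ^ 2 + T ^ 2 := by nlinarith [sq_nonneg T]
  nlinarith [sq_nonneg T, sq_nonneg x]

theorem summable_one_div_succ_sq : Summable fun k : ℕ => 1 / ((k + 1 : ℕ) : ℝ) ^ 2 :=
  (summable_nat_add_iff 1).mpr (Real.summable_one_div_nat_pow.mpr one_lt_two)

theorem summable_im_gammaStep_succ (T : ℝ) :
    Summable fun k : ℕ => (gammaStep ((k + 1 : ℕ) + T * Complex.I)).im :=
  Summable.of_norm_bounded summable_one_div_succ_sq fun k => abs_im_gammaStep_succ_le k T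

theorem continuousAt_gammaPhase {w : ℂ} (hw : w ∈ Complex.slitPlane) :
    ContinuousAt gammaPhase w := by
  have hw0 := Complex.slitPlane_ne_zero hw
  have := continuousAt_clog hw
  unfold gammaPhase
  fun_prop (disch := simpa using hw0)

/-- The step k = 0 is singular at T = 0, so only its regular parts enter the definition, outside the
series. The steps k ≥ 1 are dominated uniformly in T, which gives continuity also at T = 0, where
arguments are normalised. -/
theorem continuous_gammaArg : Continuous gammaArg := by
  have hs : ∀ (x T : ℝ), 0 < x → (x + T * Complex.I : ℂ) ∈ Complex.slitPlane := fun x T hx => by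
    rw [Complex.mem_slitPlane_iff]; left; simpa using hx
  have hcp : ∀ x : ℝ, 0 < x → Continuous fun T : ℝ => gammaPhase (x + T * Complex.I) :=
    fun x hx => continuous_iff_continuousAt.mpr fun T =>
      ContinuousAt.comp (f := fun T : ℝ => (x + T * Complex.I : ℂ))
        (continuousAt_gammaPhase (hs x T hx)) (by fun_prop)
  have hlog : ∀ x : ℝ, 0 < x → Continuous fun T : ℝ => Complex.log (x + T * Complex.I) :=
    fun x hx => continuous_iff_continuousAt.mpr fun T =>
      ContinuousAt.comp (f := fun T : ℝ => (x + T * Complex.I : ℂ))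
        (continuousAt_clog (hs x T hx)) (by fun_prop)
  refine Continuous.add (Continuous.sub ?_ ?_) (continuous_tsum (fun k => ?_)
    summable_one_div_succ_sq fun k T => abs_im_gammaStep_succ_le k T)
  · simpa [Function.comp_def] using Complex.continuous_im.comp (hcp 1 one_pos)
  · simpa [Function.comp_def, Complex.log_im] using
      Complex.continuous_im.comp (hlog (1 / 2) (by norm_num))
  · have h1 := hcp (k + 1 + 1) (by positivity)
    have h2 := hcp (k + 1) (by positivity)
    have h3 := hlog (k + 1 + 1 / 2) (by positivity)
    refine Complex.continuous_im.comp (((h1.sub h2).sub h3).congr fun T => ?_)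
    simp only [gammaStep, Pi.sub_apply]
    push_cast
    rw [add_right_comm (_ : ℂ) (1 : ℂ) (T * Complex.I : ℂ),
      add_right_comm (_ : ℂ) (1 / 2 : ℂ) (T * Complex.I : ℂ)]

/-- With m = n + 1 and w = m + iT, the limit iT of m log(1 + iT/m) cancels the imaginary part of −w,
and only T log m survives. -/
theorem tendsto_im_gammaPhase_sub (T : ℝ) :
    Tendsto (fun n : ℕ => (gammaPhase ((n + 1 : ℕ) + T * Complex.I)).im - T * Real.log n)
      atTop (𝓝 0) := by
  have h1 : Tendsto (fun n : ℕ => (n : ℂ) * Complex.log (1 + T * Complex.I / n)) atTop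
      (𝓝 (T * Complex.I)) := by
    refine Complex.tendsto_nat_mul_log_one_add_of_tendsto
      (tendsto_const_nhds.congr' ?_)
    filter_upwards [eventually_ne_atTop 0] with n hn
    have : (n : ℂ) ≠ 0 := by exact_mod_cast hn
    field_simp
  have h0 : Tendsto (fun n : ℕ => ((n + 1 : ℕ) : ℂ)⁻¹) atTop (𝓝 0) :=
    (tendsto_inv_atTop_nhds_zero_nat (𝕜 := ℂ)).comp (tendsto_add_atTop_nat 1)
  have h1' := h1.comp (tendsto_add_atTop_nat 1)
  have h2 : Tendsto (fun n : ℕ => T * Complex.I *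
      Complex.log (1 + T * Complex.I / (n + 1 : ℕ))) atTop (𝓝 0) := by
    have := (h0.mul h1').const_mul (T * Complex.I)
    rw [zero_mul, mul_zero] at this
    refine this.congr fun n => ?_
    have : ((n + 1 : ℕ) : ℂ) ≠ 0 := by exact_mod_cast n.succ_ne_zero
    simp only [Function.comp_apply]
    field_simp
  have h3 := Real.tendsto_log_nat_add_one_sub_log.const_mul T
  have h4 : Tendsto (fun n : ℕ => 1 / (24 * (((n + 1 : ℕ) : ℂ) + T * Complex.I))) atTop (𝓝 0) := by
    have : Tendsto (fun n : ℕ => 1 + T * Complex.I * ((n + 1 : ℕ) : ℂ)⁻¹) atTop (𝓝 1) := by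
      simpa using (h0.const_mul (T * Complex.I)).const_add 1
    have := (h0.mul (this.inv₀ one_ne_zero)).div_const 24
    simp only [zero_mul, zero_div] at this
    refine this.congr fun n => ?_
    have h : ((n + 1 : ℕ) : ℂ) ≠ 0 := by exact_mod_cast n.succ_ne_zero
    rw [← mul_inv, mul_add, mul_one, mul_left_comm, mul_inv_cancel₀ h, mul_one, one_div,
      mul_inv, div_eq_mul_inv, mul_comm]
  have h5 := h3.add ((Complex.continuous_im.tendsto _).comp ((h1'.add h2).sub h4))
  have h6 := h5.sub_const T
  simp only [mul_zero, zero_add, add_zero, sub_zero, Complex.im_ofReal_mul,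
    Complex.I_im, mul_one, sub_self] at h6
  refine h6.congr fun n => ?_
  have hm : (0 : ℝ) < (n + 1 : ℕ) := by positivity
  have hm' : ((n + 1 : ℕ) : ℂ) ≠ 0 := by exact_mod_cast n.succ_ne_zero
  have hlog : Complex.log ((n + 1 : ℕ) + T * Complex.I) =
      (Real.log (n + 1 : ℕ) : ℂ) + Complex.log (1 + T * Complex.I / (n + 1 : ℕ)) := by
    rw [← Complex.log_ofReal_mul hm]
    · congr 1
      push_cast at hm' ⊢
      field_simp
    · intro h
      have := congrArg Complex.re h
      rw [← Complex.ofReal_natCast, Complex.add_re, Complex.div_ofReal_re] at this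
      simp at this
  have : (gammaPhase ((n + 1 : ℕ) + T * Complex.I)) =
      ((n + 1 : ℕ) * Real.log (n + 1 : ℕ) - (n + 1 : ℕ) : ℝ)
        + ((T * Real.log (n + 1 : ℕ) - T : ℝ) : ℂ) * Complex.I
        + ((n + 1 : ℕ) * Complex.log (1 + T * Complex.I / (n + 1 : ℕ))
          + T * Complex.I * Complex.log (1 + T * Complex.I / (n + 1 : ℕ))
          - 1 / (24 * (((n + 1 : ℕ) : ℂ) + T * Complex.I))) := by
    rw [gammaPhase, hlog]
    push_cast
    ring
  rw [this, Complex.add_im, Complex.add_im, Complex.ofReal_im, Complex.im_ofReal_mul, Complex.I_im]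
  simp only [Function.comp_apply]
  push_cast
  ring

/-- The steps telescope, leaving an argument of Euler's approximation n^s n! / ∏ (s + k) at s = 1/2
+ iT. -/
theorem tendsto_gammaArg (T : ℝ) :
    Tendsto (fun n : ℕ => T * Real.log n
      - ∑ k ∈ Finset.range (n + 1), (1 / 2 + T * Complex.I + k : ℂ).arg) atTop (𝓝 (gammaArg T)) := by
  have h1 := (summable_im_gammaStep_succ T).hasSum.tendsto_sum_nat
  have h2 := (h1.sub (tendsto_im_gammaPhase_sub T)).const_add
    ((gammaPhase (1 + T * Complex.I)).im - (1 / 2 + T * Complex.I : ℂ).arg)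
  rw [sub_zero] at h2
  refine h2.congr fun n => ?_
  have h3 : ∑ k ∈ Finset.range n, gammaStep ((k + 1 : ℕ) + T * Complex.I)
      = gammaPhase ((n + 1 : ℕ) + T * Complex.I) - gammaPhase (1 + T * Complex.I)
        - ∑ k ∈ Finset.range n, Complex.log (1 / 2 + T * Complex.I + (k + 1 : ℕ)) := by
    have := Finset.sum_range_sub (fun k : ℕ => gammaPhase ((k + 1 : ℕ) + T * Complex.I)) n
    simp only [zero_add, Nat.cast_one] at this
    rw [← this, ← Finset.sum_sub_distrib]
    refine Finset.sum_congr rfl fun k _ => ?_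
    rw [gammaStep]
    push_cast
    ring_nf
  have h4 := congrArg Complex.im h3
  rw [Complex.im_sum] at h4
  rw [h4, Finset.sum_range_succ', Complex.sub_im, Complex.sub_im, Complex.im_sum]
  simp only [Complex.log_im, Nat.cast_zero, add_zero]
  ring

theorem gammaArg_zero : gammaArg 0 = 0 := by
  refine tendsto_nhds_unique (tendsto_gammaArg 0) (tendsto_const_nhds.congr fun n => ?_)
  rw [zero_mul, zero_sub, eq_comm, neg_eq_zero]
  refine Finset.sum_eq_zero fun k _ => ?_
  have : (1 / 2 + (0 : ℝ) * Complex.I + k : ℂ) = ((1 / 2 + k : ℝ) : ℂ) := by push_cast; ring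
  rw [this, Complex.arg_ofReal_of_nonneg (by positivity)]

theorem Gamma_eq_norm_mul_exp_gammaArg (T : ℝ) :
    Complex.Gamma (1 / 2 + T * Complex.I) = ‖Complex.Gamma (1 / 2 + T * Complex.I)‖ *
      Complex.exp (gammaArg T * Complex.I) := by
  have h1 := Complex.GammaSeq_tendsto_Gamma (1 / 2 + T * Complex.I)
  have h2 : Tendsto (fun n : ℕ => (‖Complex.GammaSeq (1 / 2 + T * Complex.I) n‖ : ℂ) *
      Complex.exp ((T * Real.log n
        - ∑ k ∈ Finset.range (n + 1), (1 / 2 + T * Complex.I + k : ℂ).arg : ℝ) * Complex.I))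
      atTop (𝓝 (‖Complex.Gamma (1 / 2 + T * Complex.I)‖ *
      Complex.exp (gammaArg T * Complex.I))) := by
    refine (((Complex.continuous_ofReal.tendsto _).comp h1.norm)).mul ?_
    have : Continuous fun x : ℝ => Complex.exp (x * Complex.I) := by fun_prop
    exact (this.tendsto _).comp (tendsto_gammaArg T)
  refine tendsto_nhds_unique h1 (h2.congr' ?_)
  filter_upwards [eventually_gt_atTop 0] with n hn
  have hn' : (0 : ℝ) < n := by exact_mod_cast hn
  set s : ℂ := 1 / 2 + T * Complex.I with hs
  have hsre : s.re = 1 / 2 := by simp [hs]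
  have hsim : s.im = T := by simp [hs]
  have hpow : (n : ℂ) ^ s = ‖(n : ℂ) ^ s‖ * Complex.exp ((T * Real.log n : ℝ) * Complex.I) := by
    rw [Complex.norm_natCast_cpow_of_pos hn, Complex.cpow_def_of_ne_zero (by exact_mod_cast hn.ne'),
      Real.rpow_def_of_pos hn', Complex.ofReal_exp, ← Complex.exp_add, ← Complex.natCast_log]
    congr 1
    rw [hsre, hs]
    push_cast
    ring
  have hprod : ∏ j ∈ Finset.range (n + 1), (s + j) =
      ‖∏ j ∈ Finset.range (n + 1), (s + j)‖ *
        Complex.exp ((∑ k ∈ Finset.range (n + 1), (s + k).arg : ℝ) * Complex.I) := by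
    push_cast
    rw [norm_prod, Finset.sum_mul, Complex.exp_sum]
    push_cast
    rw [← Finset.prod_mul_distrib]
    exact Finset.prod_congr rfl fun k _ => (Complex.norm_mul_exp_arg_mul_I _).symm
  have hfac : ((n.factorial : ℕ) : ℂ) = (‖((n.factorial : ℕ) : ℂ)‖ : ℂ) := by simp
  rw [Complex.GammaSeq, norm_div, norm_mul]
  conv_rhs => rw [hpow, hprod]
  rw [Complex.ofReal_sub, sub_mul, Complex.exp_sub]
  push_cast
  simp only [Complex.norm_natCast, Complex.ofReal_natCast]
  ring

/-- The term k = 0 is 1/T⁴. The others are at most the integral of the decreasing function 1/(x² +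
T²)² over (0, ∞), which is π/(4T³); J is its primitive. -/
theorem sum_one_div_sq_add_sq_le {T : ℝ} (hT : 0 < T) (n : ℕ) :
    ∑ k ∈ Finset.range n, 1 / ((k : ℝ) ^ 2 + T ^ 2) ^ 2 ≤ 1 / T ^ 4 + Real.pi / (4 * T ^ 3) := by
  let J : ℝ → ℝ := fun x => x / (2 * T ^ 2 * (x ^ 2 + T ^ 2)) + Real.arctan (x / T) / (2 * T ^ 3)
  have hJ : ∀ x, HasDerivAt J (1 / (x ^ 2 + T ^ 2) ^ 2) x := by
    intro x
    have hp : 0 < x ^ 2 + T ^ 2 := by positivity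
    have h1 := (hasDerivAt_id' x).fun_div ((((hasDerivAt_id' x).fun_pow 2).add_const
      (T ^ 2)).const_mul (2 * T ^ 2)) (by positivity)
    have h2 := (((hasDerivAt_id' x).div_const T).arctan).div_const (2 * T ^ 3)
    refine (h1.add h2).congr_deriv ?_
    have h3 : 1 + (x / T) ^ 2 = (x ^ 2 + T ^ 2) / T ^ 2 := by field_simp; ring
    rw [h3]
    field_simp
    push_cast
    ring
  have hmono : Monotone J := monotone_of_hasDerivAt_nonneg hJ fun x => by positivity
  have hlim : Tendsto J atTop (𝓝 (Real.pi / (4 * T ^ 3))) := by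
    have h1 : Tendsto (fun x : ℝ => x / (2 * T ^ 2 * (x ^ 2 + T ^ 2))) atTop (𝓝 0) := by
      refine squeeze_zero' (g := fun x => (2 * T ^ 2)⁻¹ * x⁻¹) ?_ ?_ ?_
      · filter_upwards [eventually_gt_atTop 0] with x hx
        positivity
      · filter_upwards [eventually_gt_atTop 0] with x hx
        rw [← mul_inv, ← one_div, div_le_div_iff₀ (by positivity) (by positivity)]
        nlinarith [mul_pos (pow_pos hT 2) (pow_pos hT 2)]
      · have := (tendsto_inv_atTop_zero (𝕜 := ℝ)).const_mul (2 * T ^ 2)⁻¹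
        rwa [mul_zero] at this
    have h2 : Tendsto (fun x : ℝ => Real.arctan (x / T) / (2 * T ^ 3)) atTop
        (𝓝 (Real.pi / 2 / (2 * T ^ 3))) :=
      ((Real.tendsto_arctan_atTop.mono_right nhdsWithin_le_nhds).comp
        (tendsto_id.atTop_div_const hT)).div_const _
    have h3 := h1.add h2
    rw [zero_add, div_div, show 2 * (2 * T ^ 3) = 4 * T ^ 3 by ring] at h3
    exact h3
  have hstep : ∀ k : ℕ, 1 / (((k + 1 : ℕ) : ℝ) ^ 2 + T ^ 2) ^ 2 ≤ J (k + 1 : ℕ) - J k := by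
    intro k
    obtain ⟨c, hc, hc'⟩ := exists_hasDerivAt_eq_slope J (fun x => 1 / (x ^ 2 + T ^ 2) ^ 2)
      (a := k) (b := (k + 1 : ℕ)) (by push_cast; linarith)
      (fun x _ => (hJ x).continuousAt.continuousWithinAt) fun x _ => hJ x
    have : ((k + 1 : ℕ) : ℝ) - k = 1 := by push_cast; ring
    rw [this, div_one] at hc'
    rw [← hc']
    have hc0 : 0 ≤ c := (k.cast_nonneg).trans hc.1.le
    have := hc.2.le
    gcongr
  have hJ0 : J 0 = 0 := by simp [J]
  have hsum : ∀ n : ℕ, ∑ k ∈ Finset.range (n + 1), 1 / ((k : ℝ) ^ 2 + T ^ 2) ^ 2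
      ≤ 1 / T ^ 4 + J n := by
    intro n
    induction n with
    | zero => simp [hJ0, ← pow_mul]
    | succ n ih => rw [Finset.sum_range_succ]; linarith [hstep n]
  cases n with
  | zero => simp; positivity
  | succ n => exact (hsum n).trans (by gcongr; exact hmono.ge_of_tendsto hlim _)

/-- Stirling's formula for the argument of `Γ` on the critical line. -/
theorem abs_gammaArg_sub_le {T : ℝ} (hT : 0 < T) :
    |gammaArg T - (T * Real.log T - T + 1 / (24 * T))| ≤
      7 / 960 * (1 / T ^ 4 + Real.pi / (4 * T ^ 3)) := by
  have hsum : Summable fun k : ℕ => (gammaStep (k + T * Complex.I)).im :=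
    (summable_nat_add_iff 1).mp (summable_im_gammaStep_succ T)
  have hmain : (gammaPhase (T * Complex.I)).im = T * Real.log T - T + 1 / (24 * T) := by
    have hlog : Complex.log (T * Complex.I) = Real.log T + Real.pi / 2 * Complex.I := by
      rw [Complex.log_ofReal_mul hT Complex.I_ne_zero, Complex.log_I]
    have hT' : (T : ℂ) ≠ 0 := by exact_mod_cast hT.ne'
    have : gammaPhase (T * Complex.I) = ((-T * Real.pi / 2 : ℝ) : ℂ)
        + ((T * Real.log T - T + 1 / (24 * T) : ℝ) : ℂ) * Complex.I := by
      rw [gammaPhase, hlog]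
      push_cast
      field_simp
      simp only [add_mul, mul_add, sub_mul, mul_sub, mul_assoc, Complex.I_sq]
      ring_nf
      simp only [Complex.I_sq]
      ring
    rw [this, Complex.add_im, Complex.ofReal_im, Complex.im_ofReal_mul, Complex.I_im]
    ring
  -- For T > 0 the step k = 0 can join the series; it trades the boundary terms of `gammaArg` for
  -- the value of `gammaPhase` at iT.
  have heq : gammaArg T - (T * Real.log T - T + 1 / (24 * T))
      = ∑' k : ℕ, (gammaStep (k + T * Complex.I)).im := by
    rw [hsum.tsum_eq_zero_add, gammaArg, ← hmain, gammaStep, Complex.sub_im, Complex.sub_im,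
      Complex.log_im, Nat.cast_zero, zero_add, add_comm (T * Complex.I : ℂ) 1,
      add_comm (T * Complex.I : ℂ) (1 / 2)]
    ring
  rw [heq]
  have hb : ∀ k : ℕ, |(gammaStep (k + T * Complex.I)).im|
      ≤ 7 / 960 * (1 / ((k : ℝ) ^ 2 + T ^ 2) ^ 2) := fun k =>
    (Complex.abs_im_le_norm _).trans
      ((norm_gammaStep_le k (.inl hT.ne')).trans (le_of_eq (by ring)))
  refine le_of_tendsto (continuous_abs.tendsto _ |>.comp hsum.hasSum.tendsto_sum_nat)
    (Eventually.of_forall fun n => ?_)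
  refine (Finset.abs_sum_le_sum_abs _ _).trans ((Finset.sum_le_sum fun k _ => hb k).trans ?_)
  rw [← Finset.mul_sum]
  gcongr
  exact sum_one_div_sq_add_sq_le hT n

/-! ### The argument of Γ on the line re = 1/4 and the comparison with L. -/

/-- A continuous argument of `Γ` on the right half-plane which vanishes on the real axis. -/
theorem exists_continuousOn_arg_Gamma : ∃ l : ℂ → ℝ, ContinuousOn l {z | 0 < z.re} ∧
    (∀ z : ℂ, 0 < z.re → Complex.Gamma z = ‖Complex.Gamma z‖ * Complex.exp (l z * Complex.I)) ∧
    ∀ x : ℝ, 0 < x → l x = 0 := by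
  have hne : ∀ z : ℂ, 0 < z.re → Complex.Gamma z ≠ 0 := fun z hz =>
    Complex.Gamma_ne_zero_of_re_pos hz
  have hcv : Convex ℝ {z : ℂ | 0 < z.re} := convex_halfSpace_re_gt 0
  have hsc : IsSimplyConnected {z : ℂ | 0 < z.re} := by
    have := hcv.contractibleSpace ⟨1, by simp⟩
    exact (inferInstance : SimplyConnectedSpace {z : ℂ | 0 < z.re})
  have hopen : IsOpen {z : ℂ | 0 < z.re} := isOpen_lt continuous_const Complex.continuous_re
  obtain ⟨l, hl, hle⟩ := Complex.exists_continuousOn_eqOn_exp_comp hsc hopen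
    (g := Complex.Gamma) (fun z hz => (Complex.differentiableAt_Gamma z fun m hm => by
      have := congrArg Complex.re hm
      simp only [Set.mem_ofPred_eq] at hz
      rw [this] at hz
      simp at hz
      linarith [m.cast_nonneg (α := ℝ)]).continuousAt.continuousWithinAt)
    (by rintro ⟨z, hz, h⟩; exact hne z hz h)
  have hexp : ∀ z : ℂ, 0 < z.re →
      Complex.Gamma z = ‖Complex.Gamma z‖ * Complex.exp ((l z).im * Complex.I) := by
    intro z hz
    have e : Complex.exp (l z) = Complex.Gamma z := hle hz
    rw [← e, Complex.norm_exp, Complex.ofReal_exp, ← Complex.exp_add, Complex.re_add_im]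
  have hreal : ∀ x : ℝ, 0 < x → Complex.exp ((l x).im * Complex.I) = 1 := by
    intro x hx
    have h := hexp x (by simpa using hx)
    have hG : Complex.Gamma x = ‖Complex.Gamma x‖ := by
      rw [Complex.Gamma_ofReal, Complex.norm_of_nonneg (Real.Gamma_pos_of_pos hx).le]
    have hn : (‖Complex.Gamma x‖ : ℂ) ≠ 0 := by
      simpa using hne x (by simpa using hx)
    have h2 := h.symm.trans hG
    exact mul_left_cancel₀ hn (h2.trans (mul_one _).symm)
  -- On the positive axis the imaginary part of the logarithm is a continuous multiple of 2π, hence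
  -- constant; subtracting its value at 1 normalises it.
  refine ⟨fun z => (l z).im - (l 1).im, ?_, fun z hz => ?_, fun x hx => ?_⟩
  · exact (Complex.continuous_im.comp_continuousOn hl).sub continuousOn_const
  · conv_lhs => rw [hexp z hz]
    have h1 := hreal 1 one_pos
    rw [Complex.ofReal_one] at h1
    rw [Complex.ofReal_sub, sub_mul (_ : ℂ), Complex.exp_sub, h1, div_one]
  · have := arg_unique (a := min x 1) (b := max x 1) (c := 1) (by simp)
      (F := fun _ => 1) (f := fun y => (l y).im - (l 1).im) (g := fun _ => 0) (by simp)
      (((Complex.continuous_im.comp_continuousOn hl).comp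
        Complex.continuous_ofReal.continuousOn fun y hy => by
          simpa using (lt_min hx one_pos).trans_le hy.1).sub continuousOn_const)
      continuousOn_const (fun y hy => ?_) (by simp) (by simp) x (by simp)
    · simpa using this
    · have h1 := hreal 1 one_pos
      rw [Complex.ofReal_one] at h1
      have h2 := hreal y ((lt_min hx one_pos).trans_le hy.1)
      rw [Complex.ofReal_sub, sub_mul (_ : ℂ), Complex.exp_sub, h1, h2]
      simp

/-- For z = 1/4 + iy/2 one has 1/2 − z = conj z. Reflection therefore links Γ(z + 1/2) to conj Γ(z),
duplication links it to Γ(z) and Γ(2z), and Γ(z + 1/2) is eliminated. -/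
theorem Gamma_quarter_sq (y : ℝ) :
    Complex.Gamma (1 / 4 + y / 2 * Complex.I) ^ 2 =
      ((‖Complex.Gamma (1 / 4 + y / 2 * Complex.I)‖ ^ 2 * Real.sqrt Real.pi⁻¹ : ℝ) : ℂ) *
        Complex.cos (Real.pi * (1 / 4 + y / 2 * Complex.I)) *
        Complex.Gamma (1 / 2 + y * Complex.I) * (2 : ℂ) ^ (1 / 2 - y * Complex.I) := by
  set z : ℂ := 1 / 4 + y / 2 * Complex.I with hz
  have hzre : z.re = 1 / 4 := by
    simp [hz]
  have hconj : (starRingEnd ℂ) z = 1 / 2 - z := by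
    apply Complex.ext
    · simp [hzre]; norm_num
    · simp
  have h1 := Complex.Gamma_mul_Gamma_add_half z
  have h2 := Complex.Gamma_mul_Gamma_one_sub (1 / 2 - z)
  have e1 : 1 - (1 / 2 - z) = z + 1 / 2 := by ring
  have e2 : Complex.sin (Real.pi * (1 / 2 - z)) = Complex.cos (Real.pi * z) := by
    rw [← Complex.sin_pi_div_two_sub]; congr 1; ring
  have e3 : 2 * z = 1 / 2 + y * Complex.I := by rw [hz]; ring
  have e4 : 1 - 2 * z = 1 / 2 - y * Complex.I := by rw [hz]; ring
  rw [e1, e2, ← hconj, Complex.Gamma_conj] at h2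
  rw [e4, e3] at h1
  have hh : Complex.Gamma (z + 1 / 2) ≠ 0 := Complex.Gamma_ne_zero_of_re_pos (by
    simp [hzre]; norm_num)
  have hg : Complex.Gamma z ≠ 0 := Complex.Gamma_ne_zero_of_re_pos (by
    simp [hzre])
  have hgc : (starRingEnd ℂ) (Complex.Gamma z) ≠ 0 := by simpa using hg
  have hpi : (Real.pi : ℂ) ≠ 0 := by exact_mod_cast Real.pi_ne_zero
  have hcos : Complex.cos (Real.pi * z) ≠ 0 := by
    intro h
    rw [h, div_zero] at h2
    exact mul_ne_zero hgc hh h2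
  have hn : ((‖Complex.Gamma z‖ ^ 2 : ℝ) : ℂ) = Complex.Gamma z * (starRingEnd ℂ) (Complex.Gamma z) := by
    rw [Complex.mul_conj, Complex.normSq_eq_norm_sq]
  rw [eq_div_iff hcos] at h2
  have hs : ((Real.sqrt Real.pi⁻¹ : ℝ) : ℂ) * (Real.sqrt Real.pi : ℝ) = 1 := by
    rw [← Complex.ofReal_mul, ← Real.sqrt_mul (by positivity), inv_mul_cancel₀ Real.pi_ne_zero]
    simp
  have hs2 : ((Real.sqrt Real.pi : ℝ) : ℂ) * (Real.sqrt Real.pi : ℝ) = Real.pi := by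
    rw [← Complex.ofReal_mul, Real.mul_self_sqrt Real.pi_pos.le]
  rw [Complex.ofReal_mul, hn]
  set g := Complex.Gamma z
  set g' := (starRingEnd ℂ) g
  set k := Complex.Gamma (z + 1 / 2)
  set q : ℂ := ((Real.sqrt Real.pi : ℝ) : ℂ)
  set q' : ℂ := ((Real.sqrt Real.pi⁻¹ : ℝ) : ℂ)
  have hq : q ≠ 0 := right_ne_zero_of_mul_eq_one hs
  refine mul_right_cancel₀ (mul_ne_zero hh hq) ?_
  have hk : g * g' * q' * Complex.cos (Real.pi * z) * Complex.Gamma (1 / 2 + y * Complex.I) *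
      (2 : ℂ) ^ (1 / 2 - y * Complex.I) * (k * q)
      = (g' * k * Complex.cos (Real.pi * z)) * (q' * q) * g *
        (Complex.Gamma (1 / 2 + y * Complex.I) * (2 : ℂ) ^ (1 / 2 - y * Complex.I)) := by ring
  rw [hk, h2, hs, ← hs2]
  have : g ^ 2 * (k * q) = g * q * (g * k) := by ring
  rw [this, h1]
  ring

/-- The factor of argument −π/4 is what turns the constant 1 into the 7/8 of `L`; the last factor
has exponentially small argument. -/
theorem cos_quarter_eq (y : ℝ) :
    Complex.cos (Real.pi * (1 / 4 + y / 2 * Complex.I)) =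
      ((Real.exp (Real.pi * y / 2) / 2 : ℝ) : ℂ) * Complex.exp (-(Real.pi / 4 : ℝ) * Complex.I) *
        (1 + Real.exp (-(Real.pi * y)) * Complex.I) := by
  have hI : Complex.exp ((Real.pi / 2 : ℝ) * Complex.I) = Complex.I := by
    push_cast; exact Complex.exp_pi_div_two_mul_I
  rw [Complex.cos]
  push_cast
  have h1 : Complex.exp (Real.pi * (1 / 4 + y / 2 * Complex.I) * Complex.I) =
      Complex.exp (Real.pi * y / 2) * Complex.exp (-(Real.pi / 4) * Complex.I) *
        (Complex.exp (-(Real.pi * y)) * Complex.exp (Real.pi / 2 * Complex.I)) := by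
    rw [← Complex.exp_add, ← Complex.exp_add, ← Complex.exp_add]
    congr 1
    ring_nf
    rw [Complex.I_sq]
    ring
  have h2 : Complex.exp (-(Real.pi * (1 / 4 + y / 2 * Complex.I)) * Complex.I) =
      Complex.exp (Real.pi * y / 2) * Complex.exp (-(Real.pi / 4) * Complex.I) := by
    rw [← Complex.exp_add]
    congr 1
    ring_nf
    rw [Complex.I_sq]
    ring
  push_cast at hI
  rw [h1, h2, hI]
  ring

/-- The argument of `Γ` on the line `re = 1 / 4` in terms of the one on the critical line. -/
theorem two_mul_arg_Gamma_quarter {l : ℂ → ℝ} (hl : ContinuousOn l {z | 0 < z.re})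
    (hexp : ∀ z : ℂ, 0 < z.re →
      Complex.Gamma z = ‖Complex.Gamma z‖ * Complex.exp (l z * Complex.I))
    (hreal : ∀ x : ℝ, 0 < x → l x = 0) {T : ℝ} (hT : 0 ≤ T) :
    2 * l (1 / 4 + T / 2 * Complex.I) = gammaArg T - T * Real.log 2 - Real.pi / 4
      + (1 + Real.exp (-(Real.pi * T)) * Complex.I : ℂ).arg := by
  have hre : ∀ y : ℝ, 0 < (1 / 4 + y / 2 * Complex.I : ℂ).re := fun y => by
    have : (y / 2 * Complex.I : ℂ) = ((y / 2 : ℝ) : ℂ) * Complex.I := by push_cast; ring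
    rw [this]; simp
  have hslit : ∀ y : ℝ, (1 + Real.exp (-(Real.pi * y)) * Complex.I : ℂ) ∈ Complex.slitPlane :=
    fun y => by rw [Complex.mem_slitPlane_iff]; left; simp [-Complex.ofReal_exp]
  refine arg_unique (a := 0) (b := T) (c := 0) ⟨le_rfl, hT⟩
    (F := fun y : ℝ => Complex.Gamma (1 / 4 + y / 2 * Complex.I) ^ 2)
    (f := fun y => 2 * l (1 / 4 + y / 2 * Complex.I))
    (g := fun y => gammaArg y - y * Real.log 2 - Real.pi / 4
      + (1 + Real.exp (-(Real.pi * y)) * Complex.I : ℂ).arg)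
    (fun y _ => pow_ne_zero _ (Complex.Gamma_ne_zero_of_re_pos (hre y))) ?_ ?_ ?_ ?_ ?_ T
    ⟨hT, le_rfl⟩
  · refine continuousOn_const.mul (hl.comp (Continuous.continuousOn (by fun_prop)) fun y _ => hre y)
  · refine ((continuous_gammaArg.sub (by fun_prop)).sub continuous_const).add ?_ |>.continuousOn
    exact continuous_iff_continuousAt.mpr fun y =>
      ContinuousAt.comp (f := fun y : ℝ => (1 + Real.exp (-(Real.pi * y)) * Complex.I : ℂ))
        (Complex.continuousAt_arg (hslit y)) (by fun_prop)
  · intro y _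
    conv_lhs => rw [hexp _ (hre y)]
    rw [mul_pow, ← Complex.exp_nat_mul, norm_pow]
    push_cast
    congr 2
    ring
  · intro y _
    have key : ∃ r : ℝ, 0 ≤ r ∧ Complex.Gamma (1 / 4 + y / 2 * Complex.I) ^ 2 = r *
        Complex.exp ((gammaArg y - y * Real.log 2 - Real.pi / 4
          + (1 + Real.exp (-(Real.pi * y)) * Complex.I : ℂ).arg : ℝ) * Complex.I) := by
      refine ⟨‖Complex.Gamma (1 / 4 + y / 2 * Complex.I)‖ ^ 2 * Real.sqrt Real.pi⁻¹ *
        (Real.exp (Real.pi * y / 2) / 2) * ‖(1 + Real.exp (-(Real.pi * y)) * Complex.I : ℂ)‖ *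
        ‖Complex.Gamma (1 / 2 + y * Complex.I)‖ * Real.exp (Real.log 2 * (1 / 2)),
        by positivity, ?_⟩
      have h2 : (2 : ℂ) ^ (1 / 2 - y * Complex.I) = Real.exp (Real.log 2 * (1 / 2)) *
          Complex.exp (-(y * Real.log 2 : ℝ) * Complex.I) := by
        rw [Complex.cpow_def_of_ne_zero two_ne_zero, Complex.ofReal_exp, ← Complex.exp_add]
        congr 1
        have : Complex.log 2 = (Real.log 2 : ℝ) := by
          rw [Complex.ofReal_log zero_le_two]; simp
        rw [this]
        push_cast
        ring
      rw [Gamma_quarter_sq, cos_quarter_eq, h2, Gamma_eq_norm_mul_exp_gammaArg y]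
      have h3 : Complex.exp ((gammaArg y - y * Real.log 2 - Real.pi / 4
          + (1 + Real.exp (-(Real.pi * y)) * Complex.I : ℂ).arg : ℝ) * Complex.I) =
          Complex.exp (gammaArg y * Complex.I) * Complex.exp (-(y * Real.log 2 : ℝ) * Complex.I) *
          Complex.exp (-(Real.pi / 4 : ℝ) * Complex.I) *
          Complex.exp ((1 + Real.exp (-(Real.pi * y)) * Complex.I : ℂ).arg * Complex.I) := by
        rw [← Complex.exp_add, ← Complex.exp_add, ← Complex.exp_add]
        congr 1
        push_cast
        ring
      rw [h3]
      conv_lhs => rw [← Complex.norm_mul_exp_arg_mul_I (1 + Real.exp (-(Real.pi * y)) * Complex.I)]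
      rw [norm_mul, Complex.norm_exp_ofReal_mul_I, Complex.norm_real, norm_norm, mul_one]
      push_cast
      ring
    obtain ⟨r, hr, h⟩ := key
    rw [h, norm_mul, Complex.norm_exp_ofReal_mul_I, Complex.norm_of_nonneg hr, mul_one]
  -- The two continuous arguments agree at y = 0 because arg(1 + i) = π/4 offsets −π/4.
  · have h1 := hreal (1 / 4) (by norm_num)
    have e : (1 / 4 + (0 : ℝ) / 2 * Complex.I : ℂ) = (1 / 4 : ℝ) := by push_cast; ring
    have h2 : (1 + Complex.I : ℂ).arg = Real.pi / 4 := by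
      have : (1 + Complex.I : ℂ) = ((Real.sqrt 2 : ℝ) : ℂ) *
          (Complex.cos (Real.pi / 4 : ℝ) + Complex.sin (Real.pi / 4 : ℝ) * Complex.I) := by
        rw [← Complex.ofReal_cos, ← Complex.ofReal_sin, Real.cos_pi_div_four, Real.sin_pi_div_four]
        have : ((Real.sqrt 2 : ℝ) : ℂ) * (Real.sqrt 2 : ℝ) = 2 := by
          rw [← Complex.ofReal_mul, Real.mul_self_sqrt zero_le_two]; simp
        push_cast
        linear_combination (-1 / 2 - Complex.I / 2) * this
      rw [this, Complex.arg_mul_cos_add_sin_mul_I (by positivity)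
        ⟨by linarith [Real.pi_pos], by linarith [Real.pi_pos]⟩]
    rw [e, h1]
    simp [h2, gammaArg_zero]

theorem abs_arg_one_add_le {x : ℝ} (h0 : 0 ≤ x) (h1 : x ≤ 1 / 2) :
    |(1 + x * Complex.I : ℂ).arg| ≤ 3 / 2 * x := by
  have hn : ‖(x * Complex.I : ℂ)‖ = x := by simp [abs_of_nonneg h0]
  have := Complex.norm_log_one_add_half_le_self (z := x * Complex.I) (by rwa [hn])
  rw [hn] at this
  rw [← Complex.log_im]
  exact (Complex.abs_im_le_norm _).trans this

/-- The comparison of the Riemann–Siegel theta function with its elementary main terms. -/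
theorem abs_theta_sub_L_le {l : ℂ → ℝ} (hl : ContinuousOn l {z | 0 < z.re})
    (hexp : ∀ z : ℂ, 0 < z.re →
      Complex.Gamma z = ‖Complex.Gamma z‖ * Complex.exp (l z * Complex.I))
    (hreal : ∀ x : ℝ, 0 < x → l x = 0) {T : ℝ} (hT : 2 * Real.pi ≤ T) :
    |Real.pi⁻¹ * (l (1 / 4 + T / 2 * Complex.I) - T / 2 * Real.log Real.pi) + 1 - L T|
      ≤ 1 / (150 * T) := by
  have hpi := Real.pi_gt_d6
  have hpi' := Real.pi_lt_d6
  have hT6 : 6.283 ≤ T := by linarith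
  have hT0 : 0 < T := by linarith
  have h1 := two_mul_arg_Gamma_quarter hl hexp hreal hT0.le
  have h2 := abs_gammaArg_sub_le hT0
  set E := gammaArg T - (T * Real.log T - T + 1 / (24 * T)) with hE
  set A := (1 + Real.exp (-(Real.pi * T)) * Complex.I : ℂ).arg with hA
  -- Here exp(πT) ≥ exp(T)³: one factor absorbs T, the other two exceed 2.7¹² > 10⁵.
  have hx : T * Real.exp (-(Real.pi * T)) ≤ 1 / 100000 := by
    have e1 : (2.7 : ℝ) ^ 6 ≤ Real.exp 6 := by
      have : Real.exp 6 = Real.exp 1 ^ 6 := by rw [← Real.exp_nat_mul]; norm_num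
      rw [this]
      have := Real.exp_one_gt_d9
      gcongr
      linarith
    have e2 : Real.exp 6 ≤ Real.exp T := Real.exp_le_exp.mpr (by linarith)
    have e3 : T ≤ Real.exp T := by linarith [Real.add_one_le_exp T]
    have e4 : Real.exp T * Real.exp T * Real.exp T ≤ Real.exp (Real.pi * T) := by
      rw [← Real.exp_add, ← Real.exp_add]
      exact Real.exp_le_exp.mpr (by nlinarith)
    have e5 : (100000 : ℝ) ≤ Real.exp T * Real.exp T := by
      have : (2.7 : ℝ) ^ 6 ≤ Real.exp T := e1.trans e2
      have h3 : (2.7 : ℝ) ^ 6 * 2.7 ^ 6 ≤ Real.exp T * Real.exp T := by gcongr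
      refine le_trans ?_ h3
      norm_num
    rw [Real.exp_neg, ← div_eq_mul_inv, div_le_div_iff₀ (Real.exp_pos _) (by norm_num)]
    nlinarith
  have hAb : |A| ≤ 3 / 2 * Real.exp (-(Real.pi * T)) :=
    abs_arg_one_add_le (Real.exp_pos _).le (by nlinarith [Real.exp_pos (-(Real.pi * T))])
  have hAT : |A| * T ≤ 3 / 200000 := by nlinarith
  have hET : |E| * T ≤ 0.000176 := by
    have : |E| * T ≤ 7 / 960 * (1 / T ^ 3 + Real.pi / (4 * T ^ 2)) := by
      refine (mul_le_mul_of_nonneg_right h2 hT0.le).trans (le_of_eq ?_)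
      field_simp
    refine this.trans ?_
    have h3 : 1 / T ^ 3 ≤ 1 / 6.283 ^ 3 := by gcongr
    have h4 : Real.pi / (4 * T ^ 2) ≤ 3.141593 / (4 * 6.283 ^ 2) := by gcongr
    norm_num at h3 h4 ⊢
    linarith
  have hlog : Real.log (T / (2 * Real.pi)) = Real.log T - Real.log 2 - Real.log Real.pi := by
    rw [Real.log_div hT0.ne' (by positivity), Real.log_mul two_ne_zero Real.pi_ne_zero]; ring
  have hkey : Real.pi⁻¹ * (l (1 / 4 + T / 2 * Complex.I) - T / 2 * Real.log Real.pi) + 1 - L T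
      = (1 / (48 * T) + (E + A) / 2) / Real.pi := by
    have hl2 : l (1 / 4 + T / 2 * Complex.I) = (E + (T * Real.log T - T + 1 / (24 * T))
        - T * Real.log 2 - Real.pi / 4 + A) / 2 := by rw [hE]; linarith
    rw [hl2, L, hlog]
    have := Real.pi_ne_zero
    field_simp
    ring
  rw [hkey, abs_div, abs_of_pos Real.pi_pos, div_le_div_iff₀ Real.pi_pos (by positivity), one_mul]
  have h5 : |1 / (48 * T) + (E + A) / 2| ≤ 1 / (48 * T) + (|E| + |A|) / 2 := by
    refine (abs_add_le _ _).trans ?_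
    rw [abs_of_pos (by positivity : 0 < 1 / (48 * T)), abs_div, abs_two]
    gcongr
    exact abs_add_le _ _
  have h6 : |1 / (48 * T) + (E + A) / 2| * T ≤ 1 / 48 + (0.000176 + 3 / 200000) / 2 := by
    refine (mul_le_mul_of_nonneg_right h5 hT0.le).trans ?_
    have : 1 / (48 * T) * T = 1 / 48 := by field_simp
    rw [add_mul, this]
    linarith
  -- The margin is thin: 1/(48π) ≈ 0.006631 against 1/150 ≈ 0.006667. This is why explicit bounds
  -- for E and A are needed.
  have h7 : (1 : ℝ) / 48 + (0.000176 + 3 / 200000) / 2 ≤ 3.14 / 150 := by norm_num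
  generalize |1 / (48 * T) + (E + A) / 2| = X at h6 ⊢
  nlinarith

/-! ### Absence of zeros of ζ in the real interval (0, 1). -/

/-- `1 - s` times the error of the left endpoint rule for `x ^ (-s)` on `[n + 1, n + 2]`. -/
noncomputable def zetaTerm (n : ℕ) (s : ℂ) : ℂ :=
  (1 - s) * (n + 1 : ℂ) ^ (-s) - ((n + 2 : ℂ) ^ (1 - s) - (n + 1 : ℂ) ^ (1 - s))

theorem hasDerivAt_ofReal_cpow {x : ℝ} (hx : 0 < x) (r : ℂ) :
    HasDerivAt (fun y : ℝ => (y : ℂ) ^ r) (r * (x : ℂ) ^ (r - 1)) x := by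
  have := ((hasDerivAt_id (x : ℂ)).cpow_const (c := r)
    (by simpa using Complex.ofReal_mem_slitPlane.mpr hx)).comp_ofReal
  simpa using this

/-- Over a unit interval x^(−s) varies by at most its derivative bound, which gains a power of n and
makes the series converge for re s > 0. -/
theorem norm_zetaTerm_le (n : ℕ) {s : ℂ} (hs : 0 < s.re) :
    ‖zetaTerm n s‖ ≤ ‖1 - s‖ * ‖s‖ * (n + 1 : ℝ) ^ (-s.re - 1) := by
  set a : ℝ := n + 1 with ha
  have ha0 : 0 < a := by positivity
  have h1 : ∀ x ∈ Set.Icc a (a + 1), ‖(x : ℂ) ^ (-s) - (a : ℂ) ^ (-s)‖ ≤ ‖s‖ * a ^ (-s.re - 1) := by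
    intro x hx
    have h := norm_image_sub_le_of_norm_deriv_le_segment' (f := fun y : ℝ => (y : ℂ) ^ (-s))
      (f' := fun y : ℝ => -s * (y : ℂ) ^ (-s - 1)) (a := a) (b := a + 1)
      (C := ‖s‖ * a ^ (-s.re - 1))
      (fun y hy => (hasDerivAt_ofReal_cpow (ha0.trans_le hy.1) _).hasDerivWithinAt)
      (fun y hy => by
        rw [norm_mul, norm_neg, Complex.norm_cpow_eq_rpow_re_of_pos (ha0.trans_le hy.1)]
        simp only [Complex.sub_re, Complex.neg_re, Complex.one_re]
        exact mul_le_mul_of_nonneg_left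
          (Real.rpow_le_rpow_of_nonpos ha0 hy.1 (by linarith)) (norm_nonneg _)) x hx
    refine h.trans (mul_le_of_le_one_right (by positivity) (by linarith [hx.2]))
  have h2 := norm_image_sub_le_of_norm_deriv_le_segment'
    (f := fun y : ℝ => (1 - s) * ((y - a) * (a : ℂ) ^ (-s)) - (y : ℂ) ^ (1 - s))
    (f' := fun y : ℝ => (1 - s) * (a : ℂ) ^ (-s) - (1 - s) * (y : ℂ) ^ (1 - s - 1))
    (a := a) (b := a + 1) (C := ‖1 - s‖ * (‖s‖ * a ^ (-s.re - 1)))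
    (fun y hy => by
      have d1 : HasDerivAt (fun y : ℝ => (1 - s) * ((y - a) * (a : ℂ) ^ (-s)))
          ((1 - s) * (1 * (a : ℂ) ^ (-s))) y :=
        (((Complex.ofRealCLM.hasDerivAt (x := y)).sub_const (a : ℂ)).mul_const _).const_mul _
      rw [one_mul] at d1
      exact (d1.sub (hasDerivAt_ofReal_cpow (ha0.trans_le hy.1) _)).hasDerivWithinAt)
    (fun y hy => by
      have : (1 - s - 1 : ℂ) = -s := by ring
      rw [this, ← mul_sub, norm_mul, norm_sub_rev (_ ^ _)]
      exact mul_le_mul_of_nonneg_left (h1 y ⟨hy.1, hy.2.le⟩) (norm_nonneg _))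
    (a + 1) ⟨by linarith, le_rfl⟩
  rw [add_sub_cancel_left, mul_one, ← mul_assoc ‖_‖] at h2
  refine (le_of_eq ?_).trans h2
  rw [zetaTerm, ha]
  push_cast
  congr 1
  ring_nf

theorem differentiable_zetaTerm (n : ℕ) : Differentiable ℂ (zetaTerm n) := by
  have h1 : (n + 1 : ℂ) ≠ 0 := by exact_mod_cast n.succ_ne_zero
  have h2 : (n + 2 : ℂ) ≠ 0 := by exact_mod_cast (n + 1).succ_ne_zero
  have h : ∀ c : ℂ, c ≠ 0 → ∀ u : ℂ → ℂ, Differentiable ℂ u → Differentiable ℂ fun s => c ^ u s :=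
    fun c hc u hu s => (hu s).const_cpow (.inl hc)
  exact ((differentiable_id.const_sub 1).mul (h _ h1 _ differentiable_id.neg)).sub
    ((h _ h2 _ (differentiable_id.const_sub 1)).sub (h _ h1 _ (differentiable_id.const_sub 1)))

theorem sum_zetaTerm (s : ℂ) (N : ℕ) :
    ∑ n ∈ Finset.range N, zetaTerm n s =
      (1 - s) * ∑ n ∈ Finset.range N, 1 / (n + 1 : ℂ) ^ s + 1 - (N + 1 : ℂ) ^ (1 - s) := by
  induction N with
  | zero => simp
  | succ N ih =>
    rw [Finset.sum_range_succ, ih, Finset.sum_range_succ, zetaTerm, Complex.cpow_neg]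
    push_cast
    ring_nf

theorem tsum_zetaTerm_of_one_lt_re {s : ℂ} (hs : 1 < s.re) :
    ∑' n, zetaTerm n s = 1 - riemannZeta₁ s := by
  have hs1 : s ≠ 1 := fun h => by simp [h] at hs
  have hz : (1 - s) * riemannZeta s + 1 = 1 - riemannZeta₁ s := by
    rw [riemannZeta_eq_inv_sub_mul hs1]
    have := sub_ne_zero.mpr hs1
    field_simp
    ring
  have hsumm : Summable fun n => zetaTerm n s := by
    refine Summable.of_norm_bounded (g := fun n : ℕ => ‖1 - s‖ * ‖s‖ * ((n + 1 : ℕ) : ℝ) ^ (-s.re - 1))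
      (Summable.mul_left _ ((summable_nat_add_iff 1).mpr
        (Real.summable_nat_rpow.mpr (by linarith)))) fun n => ?_
    simpa using norm_zetaTerm_le n (by linarith)
  refine tendsto_nhds_unique hsumm.hasSum.tendsto_sum_nat ?_
  simp only [sum_zetaTerm]
  have h1 : Summable fun n : ℕ => 1 / (n + 1 : ℂ) ^ s := by
    simpa using (summable_nat_add_iff 1).mpr (Complex.summable_one_div_nat_cpow.mpr hs)
  have h2 := h1.hasSum.tendsto_sum_nat
  rw [← zeta_eq_tsum_one_div_nat_add_one_cpow hs] at h2
  have h3 : Tendsto (fun N : ℕ => (N + 1 : ℂ) ^ (1 - s)) atTop (𝓝 0) := by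
    rw [tendsto_zero_iff_norm_tendsto_zero]
    have := (tendsto_rpow_neg_atTop (y := s.re - 1) (by linarith)).comp
      (tendsto_natCast_atTop_atTop.comp (tendsto_add_atTop_nat 1))
    refine this.congr fun N => ?_
    have e : (N + 1 : ℂ) = ((N + 1 : ℝ) : ℂ) := by push_cast; rfl
    rw [e, Complex.norm_cpow_eq_rpow_re_of_pos (by positivity)]
    simp
  have := ((h2.const_mul (1 - s)).add_const 1).sub h3
  rwa [sub_zero, hz] at this

/-- The analytic continuation of `∑ n ^ (-s)` to the right half-plane. -/
theorem hasSum_zetaTerm {s : ℂ} (hs : 0 < s.re) :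
    HasSum (fun n => zetaTerm n s) (1 - riemannZeta₁ s) := by
  set δ := s.re / 2 with hδ
  -- The radius leaves room for `δ + 2`, near which the Dirichlet series converges and the identity
  -- theorem can start.
  set R := ‖s‖ + 3 with hR
  have hδ0 : 0 < δ := by positivity
  let U : Set ℂ := {z | δ < z.re} ∩ Metric.ball 0 R
  have hUo : IsOpen U := (isOpen_lt continuous_const Complex.continuous_re).inter Metric.isOpen_ball
  have hUc : IsPreconnected U :=
    ((convex_halfSpace_re_gt δ).inter (convex_ball 0 R)).isPreconnected
  have hsum : Summable fun n : ℕ => (1 + R) * R * ((n + 1 : ℕ) : ℝ) ^ (-δ - 1) :=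
    Summable.mul_left _ ((summable_nat_add_iff 1).mpr
        (Real.summable_nat_rpow.mpr (by linarith)))
  have hb : ∀ (n : ℕ) (z : ℂ), z ∈ U → ‖zetaTerm n z‖ ≤ (1 + R) * R * ((n + 1 : ℕ) : ℝ) ^ (-δ - 1) := by
    rintro n z ⟨h1, h2⟩
    have h1' : δ < z.re := h1
    have h3 : ‖z‖ < R := by simpa using h2
    refine (norm_zetaTerm_le n (hδ0.trans h1')).trans ?_
    have h4 : ‖1 - z‖ ≤ 1 + R := (norm_sub_le _ _).trans (by simp; exact h3.le)
    push_cast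
    have h5 : (1 : ℝ) ≤ n + 1 := by linarith [n.cast_nonneg (α := ℝ)]
    gcongr
  have hd : DifferentiableOn ℂ (fun z => ∑' n, zetaTerm n z) U :=
    Complex.differentiableOn_tsum_of_summable_norm hsum
      (fun n => (differentiable_zetaTerm n).differentiableOn) hUo hb
  have hs0 : s ∈ U := ⟨by show δ < s.re; linarith, by simp [hR]⟩
  have heq : Set.EqOn (fun z => ∑' n, zetaTerm n z) (fun z => 1 - riemannZeta₁ z) U := by
    have h2U : (δ + 2 : ℂ) ∈ U := by
      refine ⟨by show δ < (δ + 2 : ℂ).re; simp, ?_⟩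
      have e : (δ + 2 : ℂ) = ((δ + 2 : ℝ) : ℂ) := by push_cast; rfl
      rw [mem_ball_zero_iff, e, Complex.norm_of_nonneg (by positivity), hR]
      have := Complex.re_le_norm s
      linarith
    refine (hd.analyticOnNhd hUo).eqOn_of_preconnected_of_eventuallyEq
      (z₀ := δ + 2) ((DifferentiableOn.analyticOnNhd
      (differentiable_riemannZeta₁.const_sub 1).differentiableOn hUo)) hUc h2U ?_
    have : {z : ℂ | 1 < z.re} ∈ 𝓝 (δ + 2 : ℂ) :=
      (isOpen_lt continuous_const Complex.continuous_re).mem_nhds (by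
        show 1 < (δ + 2 : ℂ).re; simp; linarith)
    filter_upwards [this] with z hz using tsum_zetaTerm_of_one_lt_re hz
  rw [← show ∑' n, zetaTerm n s = 1 - riemannZeta₁ s from heq hs0]
  exact (Summable.of_norm_bounded hsum fun n => hb n s hs0).hasSum

/-- Bernoulli's inequality for the exponent 1 − σ ∈ [0, 1]. It makes the upper bound for the sums of
`zetaTerm` at real σ telescope. -/
theorem rpow_one_sub_sub_le {σ a : ℝ} (h0 : 0 ≤ σ) (h1 : σ ≤ 1) (ha : 0 < a) :
    (1 - σ) * (a + 1) ^ (-σ) ≤ (a + 1) ^ (1 - σ) - a ^ (1 - σ) := by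
  have hb : 0 < a + 1 := by linarith
  have h := rpow_one_add_le_one_add_mul_self (s := -(1 / (a + 1))) (p := 1 - σ)
    (by rw [neg_le_neg_iff, div_le_one hb]; linarith) (by linarith) (by linarith)
  have e1 : 1 + -(1 / (a + 1)) = a / (a + 1) := by field_simp; ring
  rw [e1, Real.div_rpow ha.le hb.le, div_le_iff₀ (by positivity)] at h
  have e2 : (a + 1) ^ (-σ) = (a + 1) ^ (1 - σ) / (a + 1) := by
    rw [← Real.rpow_sub_one hb.ne']; congr 1; ring
  rw [e2]
  have e3 : (1 + (1 - σ) * -(1 / (a + 1))) * (a + 1) ^ (1 - σ) =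
    (a + 1) ^ (1 - σ) - (1 - σ) * ((a + 1) ^ (1 - σ) / (a + 1)) := by ring
  linarith

/-- `ζ` has no zeros in the real interval `(0, 1)`. -/
theorem riemannZeta_ofReal_ne_zero {σ : ℝ} (h0 : 0 < σ) (h1 : σ < 1) : riemannZeta σ ≠ 0 := by
  have hs := Complex.hasSum_re (hasSum_zetaTerm (s := σ) (by simpa using h0))
  have hle : ∀ N : ℕ, ∑ n ∈ Finset.range N, (zetaTerm n σ).re ≤
      (1 - σ) * (1 - (N + 1 : ℝ) ^ (-σ)) := by
    intro N
    induction N with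
    | zero => simp
    | succ N ih =>
      rw [Finset.sum_range_succ]
      have hr : zetaTerm N σ = (((1 - σ) * (N + 1 : ℝ) ^ (-σ)
          - ((N + 1 + 1 : ℝ) ^ (1 - σ) - (N + 1 : ℝ) ^ (1 - σ)) : ℝ) : ℂ) := by
        rw [zetaTerm]
        push_cast [Complex.ofReal_cpow (show (0 : ℝ) ≤ N + 1 by positivity),
          Complex.ofReal_cpow (show (0 : ℝ) ≤ N + 1 + 1 by positivity)]
        rw [show (N + 2 : ℂ) = N + 1 + 1 by ring]
      rw [hr, Complex.ofReal_re]
      have := rpow_one_sub_sub_le h0.le h1.le (a := N + 1) (by positivity)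
      push_cast
      linarith
  -- The series sums to at most 1 − σ < 1, whereas a zero of ζ at σ would make its sum equal to 1.
  have hlim := le_of_tendsto hs.tendsto_sum_nat (Eventually.of_forall fun N =>
    (hle N).trans (show (1 - σ) * (1 - (N + 1 : ℝ) ^ (-σ)) ≤ 1 - σ by
      have : 0 < (N + 1 : ℝ) ^ (-σ) := by positivity
      nlinarith))
  intro hz
  have hσ : (σ : ℂ) ≠ 1 := by exact_mod_cast h1.ne
  rw [riemannZeta_eq_inv_sub_mul hσ] at hz
  have : riemannZeta₁ σ = 0 := by
    rcases mul_eq_zero.mp hz with h | h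
    · exact absurd h (inv_ne_zero (sub_ne_zero.mpr hσ))
    · exact h
  rw [this] at hlim
  simp at hlim
  linarith

/-! ### The entire function ξ, its symmetries and its zeros. -/

/-- The Riemann function `ξ`, up to a factor `2`. -/
noncomputable def xi (s : ℂ) : ℂ := s * (s - 1) * completedRiemannZeta₀ s + 1

/-- Multiplying Λ(s) = Λ₀(s) − 1/s − 1/(1 − s) by s(s − 1) turns the polar part into the constant 1,
so the chosen form is visibly entire. -/
theorem differentiable_xi : Differentiable ℂ xi :=
  ((differentiable_id.mul (differentiable_id.sub_const 1)).mul
    differentiable_completedZeta₀).add_const 1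

theorem xi_one_sub (s : ℂ) : xi (1 - s) = xi s := by
  rw [xi, completedRiemannZeta₀_one_sub, xi]; ring

theorem xi_one : xi 1 = 1 := by simp [xi]

theorem xi_eq_mul_riemannZeta {s : ℂ} (hs : 0 < s.re) (hs1 : s ≠ 1) :
    xi s = s * (s - 1) * Complex.Gammaℝ s * riemannZeta s := by
  have hs0 : s ≠ 0 := fun h => by simp [h] at hs
  have h1 : 1 - s ≠ 0 := sub_ne_zero.mpr hs1.symm
  rw [riemannZeta_def_of_ne_zero hs0, mul_assoc _ (Complex.Gammaℝ s),
    mul_div_cancel₀ _ (Complex.Gammaℝ_ne_zero_of_re_pos hs), completedRiemannZeta_eq, xi]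
  field_simp
  ring

theorem Gammaℝ_conj (s : ℂ) :
    Complex.Gammaℝ ((starRingEnd ℂ) s) = (starRingEnd ℂ) (Complex.Gammaℝ s) := by
  have e : ∀ z : ℂ, (starRingEnd ℂ) z / 2 = (starRingEnd ℂ) (z / 2) := fun z => by
    rw [map_div₀, Complex.conj_ofNat]
  rw [Complex.Gammaℝ, Complex.Gammaℝ, map_mul, ← Complex.Gamma_conj, ← map_neg, e, e,
    Complex.cpow_conj _ _ (by rw [Complex.arg_ofReal_of_nonneg Real.pi_pos.le]; exact Real.pi_ne_zero.symm),
    Complex.conj_ofReal]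

theorem xi_conj (s : ℂ) : xi ((starRingEnd ℂ) s) = (starRingEnd ℂ) (xi s) := by
  have key : ∀ s : ℂ, 0 < s.re → xi ((starRingEnd ℂ) s) = (starRingEnd ℂ) (xi s) := by
    intro s hs
    rcases eq_or_ne s 1 with rfl | h1
    · simp [xi_one]
    · have h1' : (starRingEnd ℂ) s ≠ 1 := fun h => h1 (by simpa using congrArg (starRingEnd ℂ) h)
      rw [xi_eq_mul_riemannZeta hs h1, xi_eq_mul_riemannZeta (by simpa using hs) h1',
        riemannZeta_conj, Gammaℝ_conj]
      simp
  by_cases hs : 0 < s.re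
  · exact key s hs
  · have := key (1 - s) (by simp; linarith)
    rwa [map_sub, map_one, xi_one_sub, xi_one_sub] at this

/-- The functional equation reduces re ρ ≤ 0 to re ρ ≥ 1. Excluding real zeros matters later: each
zero then lies strictly above or below the real axis, so conjugation halves the count. -/
theorem zero_of_xi_eq_zero {ρ : ℂ} (h : xi ρ = 0) :
    0 < ρ.re ∧ ρ.re < 1 ∧ ρ.im ≠ 0 ∧ riemannZeta ρ = 0 := by
  have key : ∀ s : ℂ, 1 ≤ s.re → xi s ≠ 0 := by
    intro s hs h0
    rcases eq_or_ne s 1 with rfl | h1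
    · simp [xi_one] at h0
    · have hs0 : s ≠ 0 := fun h => by rw [h] at hs; norm_num at hs
      rw [xi_eq_mul_riemannZeta (by linarith) h1] at h0
      exact mul_ne_zero (mul_ne_zero (mul_ne_zero hs0 (sub_ne_zero.mpr h1))
        (Complex.Gammaℝ_ne_zero_of_re_pos (by linarith)))
        (riemannZeta_ne_zero_of_one_le_re hs) h0
  have h1 : ρ.re < 1 := by
    by_contra! h1
    exact key ρ h1 h
  have h0 : 0 < ρ.re := by
    by_contra! h0
    exact key (1 - ρ) (by simp; linarith) (by rwa [xi_one_sub])
  have hρ1 : ρ ≠ 1 := fun h => by simp [h] at h1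
  have hρ0 : ρ ≠ 0 := fun h => by simp [h] at h0
  have hz : riemannZeta ρ = 0 := by
    rw [xi_eq_mul_riemannZeta h0 hρ1] at h
    exact (mul_eq_zero.mp h).resolve_left (mul_ne_zero (mul_ne_zero hρ0 (sub_ne_zero.mpr hρ1))
        (Complex.Gammaℝ_ne_zero_of_re_pos h0))
  refine ⟨h0, h1, fun him => ?_, hz⟩
  have : ρ = (ρ.re : ℂ) := by apply Complex.ext <;> simp [him]
  rw [this] at hz
  exact riemannZeta_ofReal_ne_zero h0 h1 hz

theorem xi_eq_zero_of_riemannZeta {ρ : ℂ} (h : riemannZeta ρ = 0) (him : ρ.im ≠ 0) :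
    xi ρ = 0 := by
  rw [xi_eq_mul_riemannZeta (re_mem_of_zero h him).1 (fun h => him (by simp [h])), h, mul_zero]

theorem analyticAt_xi (z : ℂ) : AnalyticAt ℂ xi z := differentiable_xi.analyticAt z

theorem analyticOrderAt_xi_ne_top (z : ℂ) : analyticOrderAt xi z ≠ ⊤ := by
  intro h
  have := (AnalyticOnNhd.analyticOrderAt_eq_top_iff_eq_zero z (fun z => analyticAt_xi z)).mp h
  have h1 := congrFun this 1
  simp [xi_one] at h1

theorem analyticOrderNatAt_xi_eq {ρ : ℂ} (h0 : 0 < ρ.re) (him : ρ.im ≠ 0) :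
    analyticOrderNatAt xi ρ = analyticOrderNatAt riemannZeta ρ := by
  have hρ1 : ρ ≠ 1 := fun h => him (by simp [h])
  have hρ0 : ρ ≠ 0 := fun h => him (by simp [h])
  have hg : AnalyticAt ℂ (fun s => s * (s - 1) * Complex.Gammaℝ s) ρ := by
    have : AnalyticAt ℂ (fun s => ((Complex.Gammaℝ s)⁻¹)⁻¹) ρ :=
      (Complex.differentiable_Gammaℝ_inv.analyticAt ρ).inv
        (inv_ne_zero (Complex.Gammaℝ_ne_zero_of_re_pos h0))
    simp only [inv_inv] at this
    exact (analyticAt_id.mul (analyticAt_id.sub analyticAt_const)).mul this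
  have hg0 : ρ * (ρ - 1) * Complex.Gammaℝ ρ ≠ 0 :=
    mul_ne_zero (mul_ne_zero hρ0 (sub_ne_zero.mpr hρ1)) (Complex.Gammaℝ_ne_zero_of_re_pos h0)
  have hζ : AnalyticAt ℂ riemannZeta ρ := analyticOn_riemannZeta ρ (by simpa using hρ1)
  have heq : xi =ᶠ[𝓝 ρ] (fun s => s * (s - 1) * Complex.Gammaℝ s) * riemannZeta := by
    have h1 : ∀ᶠ s in 𝓝 ρ, 0 < s.re := (isOpen_lt continuous_const Complex.continuous_re).mem_nhds h0
    filter_upwards [h1, isOpen_ne.mem_nhds hρ1] with s hs hs1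
    exact xi_eq_mul_riemannZeta hs hs1
  rw [analyticOrderNatAt, analyticOrderAt_congr heq, analyticOrderAt_mul hg hζ,
    (hg.analyticOrderAt_eq_zero).mpr hg0, zero_add, analyticOrderNatAt]

theorem analyticOrderNatAt_xi_one_sub (ρ : ℂ) :
    analyticOrderNatAt xi (1 - ρ) = analyticOrderNatAt xi ρ := by
  have h : xi ∘ (fun s => 1 - s) = xi := funext fun s => xi_one_sub s
  have hd : HasDerivAt (fun s : ℂ => 1 - s) (-1) ρ := (hasDerivAt_id ρ).const_sub 1
  have := analyticOrderAt_comp_of_deriv_ne_zero (f := xi) (g := fun s : ℂ => 1 - s) (z₀ := ρ)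
    (by fun_prop) (by rw [hd.deriv]; norm_num)
  rw [h] at this
  rw [analyticOrderNatAt, analyticOrderNatAt, this]

theorem analyticOrderNatAt_xi_conj (ρ : ℂ) :
    analyticOrderNatAt xi ((starRingEnd ℂ) ρ) = analyticOrderNatAt xi ρ := by
  have h := (analyticAt_xi ρ).analyticOrderNatAt_eq_iff (analyticOrderAt_xi_ne_top ρ) |>.mp rfl
  obtain ⟨g, hg, hg0, hgeq⟩ := h
  refine ((analyticAt_xi _).analyticOrderNatAt_eq_iff (analyticOrderAt_xi_ne_top _)).mpr
    ⟨(starRingEnd ℂ) ∘ g ∘ (starRingEnd ℂ), ?_, by simpa using hg0, ?_⟩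
  · rw [Complex.analyticAt_iff_eventually_differentiableAt] at hg ⊢
    have hc : Tendsto (starRingEnd ℂ) (𝓝 ((starRingEnd ℂ) ρ)) (𝓝 ρ) := by
      have := Complex.continuous_conj.tendsto ((starRingEnd ℂ) ρ)
      rwa [Complex.conj_conj] at this
    filter_upwards [hc.eventually hg] with z hz
    have := hz.conj_conj
    rwa [Complex.conj_conj] at this
  · have hc : Tendsto (starRingEnd ℂ) (𝓝 ((starRingEnd ℂ) ρ)) (𝓝 ρ) := by
      have := Complex.continuous_conj.tendsto ((starRingEnd ℂ) ρ)
      rwa [Complex.conj_conj] at this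
    filter_upwards [hc.eventually hgeq] with z hz
    have := congrArg (starRingEnd ℂ) hz
    rw [← xi_conj, Complex.conj_conj] at this
    simpa using this

/-! ### Dividing an entire function by finitely many of its zeros. -/

/-- While the order is not exhausted the quotient vanishes at ρ, and `dslope` divides by z − ρ once
more without leaving the entire functions. -/
theorem exists_eq_pow_mul {f : ℂ → ℂ} (hf : Differentiable ℂ f) (ρ : ℂ) (n : ℕ)
    (hn : n ≤ analyticOrderAt f ρ) :
    ∃ k : ℂ → ℂ, Differentiable ℂ k ∧ ∀ z, f z = (z - ρ) ^ n * k z := by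
  induction n with
  | zero => exact ⟨f, hf, by simp⟩
  | succ n ih =>
    obtain ⟨k, hk, hfk⟩ := ih (le_trans (by exact_mod_cast n.le_succ) hn)
    have hkρ : k ρ = 0 := by
      by_contra h
      have : analyticOrderAt f ρ = n :=
        ((hf.analyticAt ρ).analyticOrderAt_eq_natCast).mpr
          ⟨k, hk.analyticAt ρ, h, Eventually.of_forall fun z => by simpa using hfk z⟩
      rw [this] at hn
      exact absurd (by exact_mod_cast hn) (Nat.not_succ_le_self n)
    refine ⟨dslope k ρ, ?_, fun z => ?_⟩
    · rw [← differentiableOn_univ] at hk ⊢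
      exact (Complex.differentiableOn_dslope univ_mem).mpr hk
    · have := sub_smul_dslope k ρ z
      rw [hkρ, sub_zero, smul_eq_mul] at this
      rw [hfk, pow_succ, mul_assoc, this]

/-- An entire function is a polynomial times an entire function without zeros in a given
finite set. -/
theorem exists_eq_prod_mul {f : ℂ → ℂ} (hf : Differentiable ℂ f)
    (hf' : ∀ z, analyticOrderAt f z ≠ ⊤) (Z : Finset ℂ) :
    ∃ h : ℂ → ℂ, Differentiable ℂ h ∧
      (∀ z, f z = (∏ ρ ∈ Z, (z - ρ) ^ analyticOrderNatAt f ρ) * h z) ∧ ∀ ρ ∈ Z, h ρ ≠ 0 := by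
  classical
  induction Z using Finset.induction_on with
  | empty => exact ⟨f, hf, by simp, by simp⟩
  | insert ρ Z hρ ih =>
    obtain ⟨h, hh, hfh, hne⟩ := ih
    have hP : Differentiable ℂ fun z => ∏ ρ ∈ Z, (z - ρ) ^ analyticOrderNatAt f ρ := by fun_prop
    have hP0 : ∏ σ ∈ Z, (ρ - σ) ^ analyticOrderNatAt f σ ≠ 0 :=
      Finset.prod_ne_zero_iff.mpr fun σ hσ => pow_ne_zero _ (sub_ne_zero.mpr fun e => hρ (e ▸ hσ))
    have hord : analyticOrderAt h ρ = analyticOrderNatAt f ρ := by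
      have h1 : f = (fun z => ∏ ρ ∈ Z, (z - ρ) ^ analyticOrderNatAt f ρ) * h := funext hfh
      rw [Nat.cast_analyticOrderNatAt (hf' ρ)]
      conv_rhs => rw [h1]
      rw [analyticOrderAt_mul (hP.analyticAt ρ) (hh.analyticAt ρ),
        ((hP.analyticAt ρ).analyticOrderAt_eq_zero).mpr hP0, zero_add]
    obtain ⟨k, hk, hhk⟩ := exists_eq_pow_mul hh ρ _ hord.ge
    refine ⟨k, hk, fun z => ?_, fun σ hσ => ?_⟩
    · rw [hfh, hhk, Finset.prod_insert hρ]; ring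
    · rcases Finset.mem_insert.mp hσ with rfl | hσ
      -- A further zero of k at the new point would push the order of h above that of f.
      · intro h0
        obtain ⟨k', hk', hkk'⟩ := exists_eq_pow_mul hk σ 1 (by
          rw [Nat.cast_one, Order.one_le_iff_ne_zero]
          exact ((hk.analyticAt σ).analyticOrderAt_ne_zero).mpr h0)
        have : (analyticOrderNatAt f σ + 1 : ℕ) ≤ analyticOrderAt h σ :=
          (natCast_le_analyticOrderAt (hh.analyticAt σ)).mpr ⟨k', hk'.analyticAt σ,
            Eventually.of_forall fun z => by
              rw [hhk, hkk', pow_one, pow_succ, smul_eq_mul, mul_assoc]⟩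
        rw [hord] at this
        exact absurd (by exact_mod_cast this) (Nat.not_succ_le_self _)
      · exact right_ne_zero_of_mul (hhk σ ▸ hne σ hσ)

/-! ### Arguments of the linear factors. -/

/-- `a` is an argument of `z`. -/
def IsArg (z : ℂ) (a : ℝ) : Prop := z = ‖z‖ * Complex.exp (a * Complex.I)

theorem isArg_arg (z : ℂ) : IsArg z z.arg := (Complex.norm_mul_exp_arg_mul_I z).symm

theorem isArg_one : IsArg 1 0 := by simp [IsArg]

theorem IsArg.mul {z w : ℂ} {a b : ℝ} (hz : IsArg z a) (hw : IsArg w b) :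
    IsArg (z * w) (a + b) := by
  unfold IsArg at *
  conv_lhs => rw [hz, hw]
  rw [norm_mul, Complex.ofReal_add, add_mul, Complex.exp_add, Complex.ofReal_mul]
  ring

theorem IsArg.inv {z : ℂ} {a : ℝ} (hz : IsArg z a) : IsArg z⁻¹ (-a) := by
  unfold IsArg at *
  conv_lhs => rw [hz]
  rw [norm_inv, Complex.ofReal_neg, neg_mul, Complex.exp_neg, mul_inv, Complex.ofReal_inv]

theorem IsArg.pow {z : ℂ} {a : ℝ} (hz : IsArg z a) (n : ℕ) : IsArg (z ^ n) (n * a) := by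
  induction n with
  | zero => simpa using isArg_one
  | succ n ih =>
    rw [pow_succ]
    have := ih.mul hz
    rwa [show (n : ℝ) * a + a = (n + 1 : ℕ) * a by push_cast; ring] at this

theorem IsArg.prod {ι : Type*} {s : Finset ι} {z : ι → ℂ} {a : ι → ℝ}
    (h : ∀ i ∈ s, IsArg (z i) (a i)) : IsArg (∏ i ∈ s, z i) (∑ i ∈ s, a i) := by
  classical
  induction s using Finset.induction_on with
  | empty => simpa using isArg_one
  | insert i s hi ih =>
    rw [Finset.prod_insert hi, Finset.sum_insert hi]
    exact (h i (Finset.mem_insert_self i s)).mul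
      (ih fun j hj => h j (Finset.mem_insert_of_mem hj))

theorem isArg_exp (w : ℂ) : IsArg (Complex.exp w) w.im := by
  rw [IsArg, Complex.norm_exp, Complex.ofReal_exp, ← Complex.exp_add, Complex.re_add_im]

theorem finite_xi_zeros (R : ℝ) : {ρ | xi ρ = 0 ∧ |ρ.im| < R}.Finite := by
  have hc : IsCompact (Set.Icc (0 : ℝ) 1 ×ℂ Set.Icc (-R) R) :=
    isCompact_Icc.reProdIm isCompact_Icc
  refine hc.inter_riemannZetaZeros_finite.subset ?_
  rintro ρ ⟨h, hR⟩
  obtain ⟨h0, h1, -, hz⟩ := zero_of_xi_eq_zero h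
  exact ⟨⟨⟨h0.le, h1.le⟩, ⟨(abs_lt.mp hR).1.le, (abs_lt.mp hR).2.le⟩⟩, hz⟩

/-- The zeros of `ξ` with imaginary part in `(-R, R)`. -/
noncomputable def xiZeros (R : ℝ) : Finset ℂ := (finite_xi_zeros R).toFinset

theorem mem_xiZeros {R : ℝ} {ρ : ℂ} : ρ ∈ xiZeros R ↔ xi ρ = 0 ∧ |ρ.im| < R := by
  simp [xiZeros]

theorem conj_mem_xiZeros {R : ℝ} {ρ : ℂ} (h : ρ ∈ xiZeros R) :
    (starRingEnd ℂ) ρ ∈ xiZeros R := by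
  rw [mem_xiZeros] at h ⊢
  rw [xi_conj, h.1]
  simpa using h.2

theorem one_sub_mem_xiZeros {R : ℝ} {ρ : ℂ} (h : ρ ∈ xiZeros R) : 1 - ρ ∈ xiZeros R := by
  rw [mem_xiZeros] at h ⊢
  rw [xi_one_sub]
  simpa using h

theorem prod_xiZeros_conj {M : Type*} [CommMonoid M] (R : ℝ) (u : ℂ → M) :
    ∏ ρ ∈ xiZeros R, u ((starRingEnd ℂ) ρ) = ∏ ρ ∈ xiZeros R, u ρ :=
  Finset.prod_bij' (fun ρ _ => (starRingEnd ℂ) ρ) (fun ρ _ => (starRingEnd ℂ) ρ)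
    (fun _ h => conj_mem_xiZeros h) (fun _ h => conj_mem_xiZeros h) (by simp) (by simp) (by simp)

theorem sum_xiZeros_conj {M : Type*} [AddCommMonoid M] (R : ℝ) (u : ℂ → M) :
    ∑ ρ ∈ xiZeros R, u ((starRingEnd ℂ) ρ) = ∑ ρ ∈ xiZeros R, u ρ :=
  Finset.sum_bij' (fun ρ _ => (starRingEnd ℂ) ρ) (fun ρ _ => (starRingEnd ℂ) ρ)
    (fun _ h => conj_mem_xiZeros h) (fun _ h => conj_mem_xiZeros h) (by simp) (by simp) (by simp)

theorem prod_xiZeros_one_sub {M : Type*} [CommMonoid M] (R : ℝ) (u : ℂ → M) :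
    ∏ ρ ∈ xiZeros R, u (1 - ρ) = ∏ ρ ∈ xiZeros R, u ρ :=
  Finset.prod_bij' (fun ρ _ => 1 - ρ) (fun ρ _ => 1 - ρ)
    (fun _ h => one_sub_mem_xiZeros h) (fun _ h => one_sub_mem_xiZeros h)
    (by simp) (by simp) (by simp)

theorem sum_xiZeros_one_sub {M : Type*} [AddCommMonoid M] (R : ℝ) (u : ℂ → M) :
    ∑ ρ ∈ xiZeros R, u (1 - ρ) = ∑ ρ ∈ xiZeros R, u ρ :=
  Finset.sum_bij' (fun ρ _ => 1 - ρ) (fun ρ _ => 1 - ρ)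
    (fun _ h => one_sub_mem_xiZeros h) (fun _ h => one_sub_mem_xiZeros h)
    (by simp) (by simp) (by simp)

/-- Conjugate zeros contribute opposite arguments, since 2 − ρ has positive real part and stays off
the cut. -/
theorem sum_arg_two_sub (R : ℝ) :
    ∑ ρ ∈ xiZeros R, analyticOrderNatAt xi ρ * (2 - ρ).arg = 0 := by
  have h := sum_xiZeros_conj R fun ρ => analyticOrderNatAt xi ρ * (2 - ρ).arg
  have h2 : ∀ ρ ∈ xiZeros R, analyticOrderNatAt xi ((starRingEnd ℂ) ρ) *
      (2 - (starRingEnd ℂ) ρ).arg = -(analyticOrderNatAt xi ρ * (2 - ρ).arg) := by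
    intro ρ hρ
    have hre := (zero_of_xi_eq_zero (mem_xiZeros.mp hρ).1).2.1
    have e : 2 - (starRingEnd ℂ) ρ = (starRingEnd ℂ) (2 - ρ) := by
      rw [map_sub, Complex.conj_ofNat]
    rw [analyticOrderNatAt_xi_conj, e, Complex.arg_conj, if_neg, mul_neg]
    intro h
    have := (Complex.arg_eq_pi_iff.mp h).1
    simp at this
    linarith
  rw [Finset.sum_congr rfl h2, Finset.sum_neg_distrib] at h
  linarith

/-- The points z and −conj z are mirror images in the imaginary axis. -/
theorem arg_add_arg_neg_conj {z : ℂ} (h : z.im ≠ 0) :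
    z.arg + (-(starRingEnd ℂ) z).arg = Real.pi * SignType.sign z.im := by
  have hne : z.arg ≠ Real.pi := fun h' => h (Complex.arg_eq_pi_iff.mp h').2
  rcases lt_or_gt_of_ne h with h | h
  · rw [Complex.arg_neg_eq_arg_sub_pi_of_im_pos (by simpa using h), Complex.arg_conj, if_neg hne,
      sign_neg h]
    simp
    ring
  · rw [Complex.arg_neg_eq_arg_add_pi_of_im_neg (by simpa using h), Complex.arg_conj, if_neg hne,
      sign_pos h]
    simp

theorem zeroCount_eq_sum {T R : ℝ} (hTR : T < R) :
    (zeroCount T : ℝ) = ∑ ρ ∈ xiZeros R,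
      if 0 < ρ.im ∧ ρ.im ≤ T then (analyticOrderNatAt xi ρ : ℝ) else 0 := by
  classical
  have hset : zerosUpTo T = ((xiZeros R).filter fun ρ => 0 < ρ.im ∧ ρ.im ≤ T : Finset ℂ) := by
    ext ρ
    rw [Finset.coe_filter]
    constructor
    · rintro ⟨h, h0, hT⟩
      exact ⟨mem_xiZeros.mpr ⟨xi_eq_zero_of_riemannZeta h h0.ne', by
        rw [abs_of_pos h0]; linarith⟩, h0, hT⟩
    · rintro ⟨h, h0, hT⟩
      exact ⟨(zero_of_xi_eq_zero (mem_xiZeros.mp h).1).2.2.2, h0, hT⟩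
  rw [zeroCount, hset, finsum_mem_coe_finset, ← Finset.sum_filter, Nat.cast_sum]
  refine Finset.sum_congr rfl fun ρ hρ => ?_
  rw [Finset.mem_filter, mem_xiZeros] at hρ
  rw [analyticOrderNatAt_xi_eq (zero_of_xi_eq_zero hρ.1.1).1 hρ.2.1.ne']

/-- Pairing ρ with 1 − conj ρ, its mirror image in the critical line, gives twice the sum as π ∑
m(ρ) sign(T − im ρ). Averaging this with its conjugate, zeros with |im ρ| > T cancel and those with
|im ρ| < T count once each, 2N(T) in all. -/
theorem sum_arg_half {T R : ℝ} (hT : 0 < T) (hTR : T < R) (hT' : T ∉ ordinates) :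
    ∑ ρ ∈ xiZeros R, analyticOrderNatAt xi ρ * (1 / 2 + T * Complex.I - ρ).arg
      = Real.pi * zeroCount T := by
  set m : ℂ → ℝ := fun ρ => analyticOrderNatAt xi ρ with hm
  have hmc : ∀ ρ, m ((starRingEnd ℂ) ρ) = m ρ := fun ρ => by
    simp only [hm, analyticOrderNatAt_xi_conj]
  have hm1 : ∀ ρ, m (1 - ρ) = m ρ := fun ρ => by simp only [hm, analyticOrderNatAt_xi_one_sub]
  have him : ∀ ρ ∈ xiZeros R, ρ.im ≠ 0 ∧ ρ.im ≠ T ∧ ρ.im ≠ -T := by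
    intro ρ hρ
    obtain ⟨h1, -⟩ := mem_xiZeros.mp hρ
    obtain ⟨-, -, h0, hz⟩ := zero_of_xi_eq_zero h1
    refine ⟨h0, fun h => hT' ⟨hT, ρ, hz, h⟩, fun h => hT' ⟨hT, (starRingEnd ℂ) ρ, ?_, ?_⟩⟩
    · rw [riemannZeta_conj, hz, map_zero]
    · simp [h]
  set A := ∑ ρ ∈ xiZeros R, m ρ * (1 / 2 + T * Complex.I - ρ).arg with hA
  have hA' : ∑ ρ ∈ xiZeros R, m ρ * (-(starRingEnd ℂ) (1 / 2 + T * Complex.I - ρ)).arg = A := by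
    rw [hA, ← sum_xiZeros_one_sub, ← sum_xiZeros_conj]
    refine Finset.sum_congr rfl fun ρ _ => ?_
    rw [hm1, hmc]
    congr 2
    simp only [map_sub, map_add, map_mul, map_div₀, map_one, Complex.conj_ofNat,
      Complex.conj_ofReal, Complex.conj_I, Complex.conj_conj]
    ring
  have h2A : A + A = Real.pi * ∑ ρ ∈ xiZeros R, m ρ * SignType.sign (T - ρ.im) := by
    nth_rewrite 1 [← hA']
    rw [hA, ← Finset.sum_add_distrib, Finset.mul_sum]
    refine Finset.sum_congr rfl fun ρ hρ => ?_
    have e : (1 / 2 + T * Complex.I - ρ).im = T - ρ.im := by simp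
    have := arg_add_arg_neg_conj (z := 1 / 2 + T * Complex.I - ρ) (by
      rw [e]; exact sub_ne_zero.mpr (him ρ hρ).2.1.symm)
    rw [e] at this
    rw [← mul_add, add_comm (Complex.arg _), this]
    ring
  have hsign : ∑ ρ ∈ xiZeros R, m ρ * SignType.sign (T - ρ.im)
      + ∑ ρ ∈ xiZeros R, m ρ * SignType.sign (T - ρ.im) = 4 * zeroCount T := by
    have hc : ∑ ρ ∈ xiZeros R, m ρ * (SignType.sign (T - ρ.im) : ℝ)
        = ∑ ρ ∈ xiZeros R, m ρ * (SignType.sign (T + ρ.im) : ℝ) := by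
      rw [← sum_xiZeros_conj]
      refine Finset.sum_congr rfl fun ρ _ => ?_
      rw [hmc]; simp
    have hN : (zeroCount T : ℝ) = ∑ ρ ∈ xiZeros R, if 0 < -ρ.im ∧ -ρ.im ≤ T then m ρ else 0 := by
      rw [zeroCount_eq_sum hTR, ← sum_xiZeros_conj]
      refine Finset.sum_congr rfl fun ρ _ => ?_
      rw [analyticOrderNatAt_xi_conj]; simp [hm]
    have h4 : 4 * (zeroCount T : ℝ) = 2 * (zeroCount T + zeroCount T) := by ring
    rw [h4]
    conv_lhs => rw [hc]
    conv_lhs => arg 1; rw [← hc]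
    conv_rhs => rw [hN]
    conv_rhs => arg 2; arg 1; rw [← hN, zeroCount_eq_sum hTR]
    rw [← Finset.sum_add_distrib, ← Finset.sum_add_distrib, Finset.mul_sum]
    refine Finset.sum_congr rfl fun ρ hρ => ?_
    obtain ⟨h0, h1, h2⟩ := him ρ hρ
    rcases lt_or_gt_of_ne h0 with h0 | h0
    · rw [sign_pos (by linarith : 0 < T - ρ.im), if_neg (fun h => by linarith [h.1])]
      rcases lt_or_gt_of_ne h2 with h2 | h2
      · rw [sign_neg (by linarith : T + ρ.im < 0), if_neg (fun h => by linarith [h.2])]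
        simp
      · rw [sign_pos (by linarith : 0 < T + ρ.im), if_pos ⟨by linarith, by linarith⟩]
        simp; ring
    · rw [sign_pos (by linarith : 0 < T + ρ.im), if_neg (fun h : 0 < -ρ.im ∧ _ => by linarith [h.1])]
      rcases lt_or_gt_of_ne h1 with h1 | h1
      · rw [sign_pos (by linarith : 0 < T - ρ.im), if_pos ⟨by linarith, by linarith⟩]
        simp [hm]; ring
      · rw [sign_neg (by linarith : T - ρ.im < 0), if_neg (fun h => by linarith [h.2])]
        simp
  set B := ∑ ρ ∈ xiZeros R, m ρ * (SignType.sign (T - ρ.im) : ℝ)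
  have hB : B = 2 * zeroCount T := by linarith
  rw [hB] at h2A
  linarith

/-! ### The Riemann–von Mangoldt formula. -/

/-- A continuous function with values in (π/2)ℤ is constant on an interval. -/
theorem eq_of_exp_four_mul_eq_one {a b : ℝ} {u : ℝ → ℝ} (hu : ContinuousOn u (Set.Icc a b))
    (h : ∀ x ∈ Set.Icc a b, Complex.exp ((4 * u x : ℝ) * Complex.I) = 1) {x y : ℝ}
    (hx : x ∈ Set.Icc a b) (hy : y ∈ Set.Icc a b) : u x = u y := by
  have := arg_unique hy (F := fun _ => 1) (f := fun x => 4 * u x - 4 * u y) (g := fun _ => 0)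
    (by simp) ((continuousOn_const.mul hu).sub continuousOn_const) continuousOn_const
    (fun z hz => by
      rw [Complex.ofReal_sub, sub_mul (_ : ℂ), Complex.exp_sub, h z hz, h y hy]; simp)
    (by simp) (by simp) x hx
  linarith

/-- A continuous argument of the part of `ξ` without zeros in a strip; it is constant on the real
axis and on the critical line. -/
theorem exists_xi_factor (R : ℝ) (hR : 0 < R) : ∃ (h : ℂ → ℂ) (u : ℂ → ℝ),
    (∀ z, xi z = (∏ ρ ∈ xiZeros R, (z - ρ) ^ analyticOrderNatAt xi ρ) * h z) ∧
    ContinuousOn u {z | |z.im| < R} ∧ (∀ z, |z.im| < R → IsArg (h z) (u z)) ∧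
    ∀ T : ℝ, 0 ≤ T → T < R → u (1 / 2 + T * Complex.I) = u 2 := by
  obtain ⟨h, hh, hfac, hne⟩ := exists_eq_prod_mul differentiable_xi analyticOrderAt_xi_ne_top
    (xiZeros R)
  have hne' : ∀ z : ℂ, |z.im| < R → h z ≠ 0 := by
    intro z hz h0
    exact hne z (mem_xiZeros.mpr ⟨by rw [hfac, h0, mul_zero], hz⟩) h0
  have hset : {z : ℂ | |z.im| < R} = {z | -R < z.im} ∩ {z | z.im < R} := by
    exact Set.ext fun z => abs_lt (a := z.im) (b := R)
  have hcv : Convex ℝ {z : ℂ | |z.im| < R} := by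
    rw [hset]; exact (convex_halfSpace_im_gt _).inter (convex_halfSpace_im_lt _)
  have hsc : IsSimplyConnected {z : ℂ | |z.im| < R} := by
    have := hcv.contractibleSpace ⟨0, by simpa using hR⟩
    exact (inferInstance : SimplyConnectedSpace {z : ℂ | |z.im| < R})
  have hopen : IsOpen {z : ℂ | |z.im| < R} :=
    isOpen_lt (continuous_abs.comp Complex.continuous_im) continuous_const
  obtain ⟨l, hl, hle⟩ := Complex.exists_continuousOn_eqOn_exp_comp hsc hopen
    hh.continuous.continuousOn (by rintro ⟨z, hz, h0⟩; exact hne' z hz h0)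
  have harg : ∀ z : ℂ, |z.im| < R → IsArg (h z) (l z).im := fun z hz => by
    rw [← show Complex.exp (l z) = h z from hle hz]; exact isArg_exp _
  set P : ℂ → ℂ := fun z => ∏ ρ ∈ xiZeros R, (z - ρ) ^ analyticOrderNatAt xi ρ with hP
  have hPc : Continuous P := by fun_prop
  have hPne : ∀ z ∈ ((xiZeros R : Set ℂ))ᶜ, P z ≠ 0 := fun z hz =>
    Finset.prod_ne_zero_iff.mpr fun ρ hρ => pow_ne_zero _ (sub_ne_zero.mpr fun e =>
      hz (by rw [e]; exact hρ))
  -- P can be cancelled only off its zeros; continuity of h carries the resulting identities to the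
  -- whole plane.
  have hdense : Dense ((xiZeros R : Set ℂ))ᶜ := (xiZeros R).finite_toSet.countable.dense_compl ℂ
  have hPconj : ∀ z, P ((starRingEnd ℂ) z) = (starRingEnd ℂ) (P z) := by
    intro z
    simp only [hP]
    rw [← prod_xiZeros_conj, map_prod]
    refine Finset.prod_congr rfl fun ρ _ => ?_
    rw [analyticOrderNatAt_xi_conj, map_pow, map_sub]
  -- Each linear factor changes sign under z ↦ 1 − z, up to reindexing; squaring avoids the parity
  -- of their number.
  have hPsq : ∀ z, P (1 - z) ^ 2 = P z ^ 2 := by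
    intro z
    simp only [hP]
    rw [← prod_xiZeros_one_sub, ← Finset.prod_pow, ← Finset.prod_pow]
    refine Finset.prod_congr rfl fun ρ _ => ?_
    rw [analyticOrderNatAt_xi_one_sub, ← pow_mul, ← pow_mul, mul_comm _ 2, pow_mul, pow_mul]
    congr 1
    ring
  have hhconj : ∀ z, h ((starRingEnd ℂ) z) = (starRingEnd ℂ) (h z) := by
    have hc : Continuous h := hh.continuous
    refine congrFun (Continuous.ext_on hdense (hc.comp Complex.continuous_conj)
      (Complex.continuous_conj.comp hc) fun z hz => ?_)
    have h1 := xi_conj z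
    rw [hfac, hfac z, map_mul] at h1
    change P _ * _ = (starRingEnd ℂ) (P z) * _ at h1
    rw [hPconj] at h1
    exact mul_left_cancel₀ (by simpa using hPne z hz) h1
  have hhsq : ∀ z, h (1 - z) ^ 2 = h z ^ 2 := by
    have hc : Continuous h := hh.continuous
    refine congrFun (Continuous.ext_on hdense ((hc.comp (continuous_const.sub continuous_id)).pow 2)
      (hc.pow 2) fun z hz => ?_)
    have h1 := congrArg (· ^ 2) (xi_one_sub z)
    simp only [hfac (1 - z), hfac z, mul_pow] at h1
    change P _ ^ 2 * _ = P z ^ 2 * _ at h1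
    rw [hPsq] at h1
    exact mul_left_cancel₀ (pow_ne_zero 2 (hPne z hz)) h1
  -- The hypothesis gives h⁴ = |h|⁴ > 0. It holds on the real axis, where h is real, and on the
  -- critical line, where conj z = 1 − z.
  have hone : ∀ z : ℂ, |z.im| < R → (starRingEnd ℂ) (h z) ^ 2 = h z ^ 2 →
      Complex.exp ((4 * (l z).im : ℝ) * Complex.I) = 1 := by
    intro z hz hsq
    have h4 := (harg z hz).pow 4
    have hn : (‖h z ^ 4‖ : ℂ) ≠ 0 := by simpa using hne' z hz
    have e : h z ^ 4 = ‖h z ^ 4‖ := by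
      have : h z ^ 4 = h z ^ 2 * (starRingEnd ℂ) (h z) ^ 2 := by rw [hsq]; ring
      rw [this, ← mul_pow, Complex.mul_conj, norm_pow, Complex.norm_real,
        Real.norm_of_nonneg (Complex.normSq_nonneg _)]
      push_cast
      rfl
    have h5 := h4.symm.trans e
    push_cast at h5 hn ⊢
    exact mul_left_cancel₀ hn (h5.trans (mul_one _).symm)
  refine ⟨h, fun z => (l z).im, hfac, Complex.continuous_im.comp_continuousOn hl, harg,
    fun T hT0 hTR => ?_⟩
  have hcont : ∀ (c : ℝ → ℂ) (a b : ℝ), Continuous c → (∀ x ∈ Set.Icc a b, |(c x).im| < R) →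
      ContinuousOn (fun x => (l (c x)).im) (Set.Icc a b) := fun c a b hc hcR =>
    (Complex.continuous_im.comp_continuousOn hl).comp hc.continuousOn hcR
  have e1 : (l (1 / 2 + T * Complex.I)).im = (l (1 / 2 + (0 : ℝ) * Complex.I)).im := by
    have him : ∀ x ∈ Set.Icc 0 T, |(1 / 2 + x * Complex.I : ℂ).im| < R := fun x hx => by
      have : (1 / 2 + x * Complex.I : ℂ).im = x := by simp
      rw [this, abs_of_nonneg hx.1]
      exact hx.2.trans_lt hTR
    refine eq_of_exp_four_mul_eq_one (u := fun x : ℝ => (l (1 / 2 + x * Complex.I)).im)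
      (a := 0) (b := T) (hcont (fun x => 1 / 2 + x * Complex.I) 0 T (by fun_prop) him)
      (fun x hx => hone _ (him x hx) ?_) ⟨hT0, le_rfl⟩ ⟨le_rfl, hT0⟩
    rw [← hhconj, ← hhsq]
    congr 2
    simp only [map_add, map_mul, map_div₀, map_one, Complex.conj_ofNat,
      Complex.conj_ofReal, Complex.conj_I]
    ring
  have e2 : (l ((1 / 2 : ℝ) : ℂ)).im = (l ((2 : ℝ) : ℂ)).im := by
    have him : ∀ x ∈ Set.Icc (1 / 2 : ℝ) 2, |(x : ℂ).im| < R := fun x hx => by simpa using hR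
    refine eq_of_exp_four_mul_eq_one (u := fun x : ℝ => (l x).im)
      (a := 1 / 2) (b := 2) (hcont (fun x => x) _ _ (by fun_prop) him)
      (fun x hx => hone _ (him x hx) ?_) (by norm_num) (by norm_num)
    rw [← hhconj, Complex.conj_ofReal]
  simp only [e1]
  push_cast at e2 ⊢
  rw [zero_mul, add_zero, e2]

theorem IsArg.sub_of_exp_eq_one {z : ℂ} {a b : ℝ} (hz : IsArg z a)
    (hb : Complex.exp (b * Complex.I) = 1) : IsArg z (a - b) := by
  unfold IsArg at *
  rw [Complex.ofReal_sub, sub_mul (_ : ℂ), Complex.exp_sub, hb, div_one]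
  exact hz

/-- The Riemann–von Mangoldt formula. -/
theorem zetaArg_eq {l : ℂ → ℝ} (hl : ContinuousOn l {z | 0 < z.re})
    (hexp : ∀ z : ℂ, 0 < z.re → IsArg (Complex.Gamma z) (l z))
    (hreal : ∀ x : ℝ, 0 < x → l x = 0) {T : ℝ} (hT : 0 < T) (hT' : T ∉ ordinates) :
    zetaArg T = Real.pi * zeroCount T - Real.pi + T / 2 * Real.log Real.pi
      - l (1 / 4 + T / 2 * Complex.I) := by
  set R := T + 1 with hR
  have hTR : T < R := by linarith
  obtain ⟨h, u, hfac, hu, hhu, huc⟩ := exists_xi_factor R (by linarith)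
  -- One argument for each factor of ζ. The principal ones vary continuously along the path: s − ρ
  -- and s − 1 have positive real part on the vertical side and nonzero imaginary part on the
  -- horizontal one.
  let A : ℂ → ℝ := fun s => ∑ ρ ∈ xiZeros R, analyticOrderNatAt xi ρ * (s - ρ).arg + u s
    + -s.arg + -(s - 1).arg + s.im / 2 * Real.log Real.pi + -l (s / 2)
  have hre2 : ∀ s : ℂ, 0 < s.re → 0 < (s / 2).re := fun s hs => by simpa using hs
  have hA : ∀ s : ℂ, 0 < s.re → s ≠ 1 → |s.im| < R → IsArg (riemannZeta s) (A s) := by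
    intro s hs hs1 him
    have hs0 : s ≠ 0 := fun h => by simp [h] at hs
    have hz : riemannZeta s = (∏ ρ ∈ xiZeros R, (s - ρ) ^ analyticOrderNatAt xi ρ) * h s
        * s⁻¹ * (s - 1)⁻¹ * Complex.exp (Real.log Real.pi * s / 2) * (Complex.Gamma (s / 2))⁻¹ := by
      rw [← hfac, xi_eq_mul_riemannZeta hs hs1, Complex.Gammaℝ_def]
      have h1 : (Real.pi : ℂ) ^ (-s / 2) * Complex.exp (Real.log Real.pi * s / 2) = 1 := by
        rw [Complex.cpow_def_of_ne_zero (by exact_mod_cast Real.pi_ne_zero),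
          ← Complex.ofReal_log Real.pi_pos.le, ← Complex.exp_add]
        rw [show (Real.log Real.pi : ℂ) * (-s / 2) + Real.log Real.pi * s / 2 = 0 by ring,
          Complex.exp_zero]
      have h2 := mul_inv_cancel₀ (Complex.Gamma_ne_zero_of_re_pos (hre2 s hs))
      have h3 := mul_inv_cancel₀ hs0
      have h4 := mul_inv_cancel₀ (sub_ne_zero.mpr hs1)
      calc riemannZeta s = (s * s⁻¹) * ((s - 1) * (s - 1)⁻¹) *
            ((Real.pi : ℂ) ^ (-s / 2) * Complex.exp (Real.log Real.pi * s / 2)) *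
            (Complex.Gamma (s / 2) * (Complex.Gamma (s / 2))⁻¹) * riemannZeta s := by
              rw [h1, h2, h3, h4]; ring
        _ = _ := by ring
    rw [hz]
    refine (((((IsArg.prod fun ρ _ => (isArg_arg _).pow _).mul (hhu s him)).mul
      (isArg_arg s).inv).mul (isArg_arg _).inv).mul ?_).mul (hexp _ (hre2 s hs)).inv
    convert isArg_exp _ using 1
    rw [mul_div_assoc, Complex.im_ofReal_mul]
    have : (s / 2).im = s.im / 2 := by simp
    rw [this]
    ring
  have hAc : ∀ (c : ℝ → ℂ) (a b : ℝ), Continuous c →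
      (∀ x ∈ Set.Icc a b, 0 < (c x).re ∧ |(c x).im| < R ∧ c x - 1 ∈ Complex.slitPlane ∧
        ∀ ρ ∈ xiZeros R, c x - ρ ∈ Complex.slitPlane) →
      ContinuousOn (fun x => A (c x)) (Set.Icc a b) := by
    intro c a b hc hcx
    have hca : ∀ w : ℂ, (∀ x ∈ Set.Icc a b, c x - w ∈ Complex.slitPlane) →
        ContinuousOn (fun x => (c x - w).arg) (Set.Icc a b) := fun w hw x hx =>
      (ContinuousAt.comp (f := fun x => c x - w) (Complex.continuousAt_arg (hw x hx))
        (by fun_prop)).continuousWithinAt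
    refine (((((ContinuousOn.add ?_ ?_).add ?_).add ?_).add ?_).add ?_)
    · exact continuousOn_finsetSum _ fun ρ hρ =>
        continuousOn_const.mul (hca ρ fun x hx => (hcx x hx).2.2.2 ρ hρ)
    · exact hu.comp hc.continuousOn fun x hx => (hcx x hx).2.1
    · have := hca 0 fun x hx => by
        rw [sub_zero]; exact Complex.mem_slitPlane_iff.mpr (.inl (hcx x hx).1)
      simp only [sub_zero] at this
      exact this.neg
    · exact (hca 1 fun x hx => (hcx x hx).2.2.1).neg
    · exact Continuous.continuousOn (by fun_prop)
    · exact (hl.comp (hc.div_const 2).continuousOn fun x hx => hre2 _ (hcx x hx).1).neg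
  have hA2 : A 2 = u 2 := by
    have h1 := hreal 1 one_pos
    rw [Complex.ofReal_one] at h1
    have h2 : (2 - 1 : ℂ) = 1 := by norm_num
    simp only [A]
    rw [sum_arg_two_sub, h2, div_self two_ne_zero, h1, Complex.arg_one]
    simp
  have hre : ∀ ρ ∈ xiZeros R, ρ.re < 1 := fun ρ hρ =>
    (zero_of_xi_eq_zero (mem_xiZeros.mp hρ).1).2.1
  have him : ∀ ρ ∈ xiZeros R, ρ.im ≠ T := fun ρ hρ h =>
    hT' ⟨hT, ρ, (zero_of_xi_eq_zero (mem_xiZeros.mp hρ).1).2.2.2, h⟩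
  -- The function u is fixed only up to a constant, so A(2) need not be 0; since ζ(2) > 0 it is a
  -- multiple of 2π and may be subtracted.
  have hexp2 : Complex.exp (A 2 * Complex.I) = 1 := by
    have h2 := hA 2 (by norm_num) (by norm_num) (by simp; linarith)
    have e : riemannZeta 2 = ‖riemannZeta 2‖ := by
      have e : riemannZeta 2 = ((Real.pi ^ 2 / 6 : ℝ) : ℂ) := by
        rw [riemannZeta_two]; push_cast; ring
      rw [e, Complex.norm_of_nonneg (by positivity)]
    have hn : (‖riemannZeta 2‖ : ℂ) ≠ 0 := by
      simpa using riemannZeta_ne_zero_of_one_le_re (s := 2) (by norm_num)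
    exact mul_left_cancel₀ hn (h2.symm.trans (e.trans (mul_one _).symm))
  have hv : ∀ y ∈ Set.Icc 0 T, 0 < (2 + y * Complex.I : ℂ).re ∧ |(2 + y * Complex.I : ℂ).im| < R ∧
      (2 + y * Complex.I : ℂ) - 1 ∈ Complex.slitPlane ∧
        ∀ ρ ∈ xiZeros R, (2 + y * Complex.I : ℂ) - ρ ∈ Complex.slitPlane := by
    intro y hy
    refine ⟨by simp, ?_, ?_, fun ρ hρ => ?_⟩
    · have : (2 + y * Complex.I : ℂ).im = y := by simp
      rw [this, abs_of_nonneg hy.1]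
      linarith [hy.2]
    · rw [Complex.mem_slitPlane_iff]; left; norm_num
    · rw [Complex.mem_slitPlane_iff]; left
      simp
      linarith [hre ρ hρ]
  have hh : ∀ x ∈ Set.Icc (1 / 2 : ℝ) 2, 0 < (x + T * Complex.I : ℂ).re ∧
      |(x + T * Complex.I : ℂ).im| < R ∧ (x + T * Complex.I : ℂ) - 1 ∈ Complex.slitPlane ∧
        ∀ ρ ∈ xiZeros R, (x + T * Complex.I : ℂ) - ρ ∈ Complex.slitPlane := by
    intro x hx
    refine ⟨?_, ?_, ?_, fun ρ hρ => ?_⟩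
    · have : (x + T * Complex.I : ℂ).re = x := by simp
      rw [this]; linarith [hx.1]
    · have : (x + T * Complex.I : ℂ).im = T := by simp
      rw [this, abs_of_pos hT]; exact hTR
    · rw [Complex.mem_slitPlane_iff]; right; simpa using hT.ne'
    · rw [Complex.mem_slitPlane_iff]; right
      simpa using sub_ne_zero.mpr (him ρ hρ).symm
  have hne1 : ∀ s : ℂ, s - 1 ∈ Complex.slitPlane → s ≠ 1 := fun s hs h =>
    Complex.slitPlane_ne_zero hs (by rw [h, sub_self])
  have hIs : IsZetaArg T (A (1 / 2 + T * Complex.I) - A 2) := by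
    refine ⟨fun y => A (2 + y * Complex.I) - A 2, fun x => A (x + T * Complex.I) - A 2,
      (hAc _ 0 T (by fun_prop) hv).sub continuousOn_const,
      (hAc _ (1 / 2) 2 (by fun_prop) hh).sub continuousOn_const, fun y hy => ?_, fun x hx => ?_,
      by simp, by simp, by simp⟩
    · obtain ⟨h1, h2, h3, -⟩ := hv y hy
      exact (hA _ h1 (hne1 _ h3) h2).sub_of_exp_eq_one hexp2
    · obtain ⟨h1, h2, h3, -⟩ := hh x hx
      exact (hA _ h1 (hne1 _ h3) h2).sub_of_exp_eq_one hexp2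
  have hval := (existsUnique_isZetaArg hT hT').unique (isZetaArg_zetaArg hT hT') hIs
  rw [hval, hA2]
  -- On the critical line s and s − 1 are mirror images; this is the source of −π, the 1 in 1 + ϑ/π.
  have hargs : (1 / 2 + T * Complex.I : ℂ).arg + (1 / 2 + T * Complex.I - 1 : ℂ).arg = Real.pi := by
    have := arg_add_arg_neg_conj (z := 1 / 2 + T * Complex.I) (by simpa using hT.ne')
    have e : (1 / 2 + T * Complex.I : ℂ).im = T := by simp
    rw [e, sign_pos hT] at this
    rw [show (1 / 2 + T * Complex.I - 1 : ℂ) = -(starRingEnd ℂ) (1 / 2 + T * Complex.I) by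
      simp only [map_add, map_mul, map_div₀, map_one, Complex.conj_ofNat,
        Complex.conj_ofReal, Complex.conj_I]
      ring, this]
    simp
  have e1 : ((1 / 2 + T * Complex.I) / 2 : ℂ) = 1 / 4 + T / 2 * Complex.I := by ring
  have e2 : (1 / 2 + T * Complex.I : ℂ).im = T := by simp
  simp only [A]
  rw [sum_arg_half hT hTR hT', huc T hT.le hTR, e1, e2]
  linarith

/-! ### Means at ordinates and the conclusion. -/

theorem finite_ordinates_lt (T : ℝ) : (ordinates ∩ Set.Iio T).Finite := by
  refine ((zerosUpTo_finite T).image Complex.im).subset ?_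
  rintro γ ⟨⟨h0, ρ, hρ, rfl⟩, hT⟩
  exact ⟨ρ, ⟨hρ, h0, le_of_lt hT⟩, rfl⟩

theorem exists_forall_notMem_ordinates {t : ℝ} (ht : 0 < t) :
    ∃ η > 0, η < t ∧ ∀ T, T ≠ t → |T - t| < η → T ∉ ordinates := by
  have hfin : ((ordinates ∩ Set.Iio (2 * t)) \ {t}).Finite :=
    (finite_ordinates_lt (2 * t)).subset Set.sdiff_subset
  have hmem : ((ordinates ∩ Set.Iio (2 * t)) \ {t})ᶜ ∈ 𝓝 t :=
    hfin.isClosed.isOpen_compl.mem_nhds (by simp)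
  obtain ⟨η, hη, hb⟩ := Metric.mem_nhds_iff.mp hmem
  refine ⟨min η (t / 2), lt_min hη (by linarith), (min_le_right _ _).trans_lt (by linarith),
    fun T hT hTη hord => ?_⟩
  refine hb (show T ∈ _ by
    rw [Metric.mem_ball, Real.dist_eq]; exact hTη.trans_le (min_le_left _ _)) ⟨⟨hord, ?_⟩, hT⟩
  have := (abs_lt.mp (hTη.trans_le (min_le_right _ _))).2
  simp only [Set.mem_Iio]
  linarith

/-- Near an ordinate, the mean of the numbers of zeros on both sides is constant. -/
theorem exists_eventually_symmMean_N₀_eq {t : ℝ} (ht : 0 < t) :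
    ∃ c : ℝ, ∀ᶠ δ in 𝓝[≠] (0 : ℝ), symmMean N₀ t δ = c := by
  obtain ⟨η, hη, hηt, hord⟩ := exists_forall_notMem_ordinates ht
  let B : ℕ := ∑ᶠ ρ ∈ {ρ : ℂ | riemannZeta ρ = 0 ∧ 0 < ρ.im ∧ ρ.im < t},
    analyticOrderNatAt riemannZeta ρ
  have hup : ∀ δ, 0 < δ → δ < η → zeroCount (t + δ) = zeroCount t := by
    intro δ h0 h1
    have : zerosUpTo (t + δ) = zerosUpTo t := by
      ext ρ
      refine ⟨fun ⟨hz, hp, hle⟩ => ⟨hz, hp, ?_⟩, fun ⟨hz, hp, hle⟩ => ⟨hz, hp, by linarith⟩⟩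
      by_contra! hlt
      exact hord ρ.im hlt.ne' (by rw [abs_lt]; constructor <;> linarith) ⟨hp, ρ, hz, rfl⟩
    rw [zeroCount, this, zeroCount]
  have hdown : ∀ δ, 0 < δ → δ < η → zeroCount (t - δ) = B := by
    intro δ h0 h1
    have : zerosUpTo (t - δ) = {ρ : ℂ | riemannZeta ρ = 0 ∧ 0 < ρ.im ∧ ρ.im < t} := by
      ext ρ
      refine ⟨fun ⟨hz, hp, hle⟩ => ⟨hz, hp, by linarith⟩, fun ⟨hz, hp, hlt⟩ => ⟨hz, hp, ?_⟩⟩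
      by_contra! hle
      exact hord ρ.im hlt.ne (by rw [abs_lt]; constructor <;> linarith) ⟨hp, ρ, hz, rfl⟩
    rw [zeroCount, this]
  refine ⟨(B + zeroCount t) / 2, ?_⟩
  have h1 : ∀ᶠ δ in 𝓝[≠] (0 : ℝ), |δ| < η :=
    mem_nhdsWithin_of_mem_nhds ((isOpen_lt continuous_abs continuous_const).mem_nhds (by simpa using hη))
  filter_upwards [h1, self_mem_nhdsWithin] with δ hδ h0
  rcases lt_or_gt_of_ne (show δ ≠ 0 from h0) with h | h
  -- A negative δ only swaps the two sides of t.
  · rw [abs_of_neg h] at hδ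
    rw [symmMean, N₀, N₀, show t - δ = t + -δ by ring, show t + δ = t - -δ by ring,
      hup (-δ) (by linarith) hδ, hdown (-δ) (by linarith) hδ, add_comm]
  · rw [abs_of_pos h] at hδ
    rw [symmMean, N₀, N₀, hup δ h hδ, hdown δ h hδ]

theorem tendsto_symmMean {u : ℝ → ℝ} {t : ℝ} (hu : ContinuousAt u t) :
    Tendsto (symmMean u t) (𝓝[≠] 0) (𝓝 (u t)) := by
  have h1 : Tendsto (fun δ : ℝ => t - δ) (𝓝[≠] 0) (𝓝 t) := by
    have : Continuous fun δ : ℝ => t - δ := by fun_prop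
    simpa using (this.tendsto 0).mono_left nhdsWithin_le_nhds
  have h2 : Tendsto (fun δ : ℝ => t + δ) (𝓝[≠] 0) (𝓝 t) := by
    have : Continuous fun δ : ℝ => t + δ := by fun_prop
    simpa using (this.tendsto 0).mono_left nhdsWithin_le_nhds
  have := ((hu.tendsto.comp h1).add (hu.tendsto.comp h2)).div_const 2
  rw [add_self_div_two] at this
  exact this

end ZetaCount

/-- For `t ≥ 2π`: if `t` is the ordinate of a zero of `ζ`, then the limits that define `N(t)` and
`S(t)` exist; and in all cases `|Q(t) - S(t)| ≤ 1 / (150 t)`. -/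
theorem lemma2 (t : ℝ) (ht : 2 * Real.pi ≤ t) :
    (t ∈ ZetaCount.ordinates →
      Filter.Tendsto (ZetaCount.symmMean ZetaCount.N₀ t) (nhdsWithin 0 {0}ᶜ)
        (nhds (ZetaCount.N t)) ∧
      Filter.Tendsto (ZetaCount.symmMean ZetaCount.S₀ t) (nhdsWithin 0 {0}ᶜ)
        (nhds (ZetaCount.S t))) ∧
    |ZetaCount.Q t - ZetaCount.S t| ≤ 1 / (150 * t) := by
  open ZetaCount in
  have ht0 : 0 < t := lt_of_lt_of_le (by positivity) ht
  obtain ⟨l, hl, hexp, hreal⟩ := exists_continuousOn_arg_Gamma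
  let Θ : ℝ → ℝ := fun T =>
    Real.pi⁻¹ * (l (1 / 4 + T / 2 * Complex.I) - T / 2 * Real.log Real.pi) + 1
  have hmain : ∀ T, 0 < T → T ∉ ordinates → S₀ T = N₀ T - Θ T := by
    intro T hT hT'
    have := Real.pi_ne_zero
    rw [S₀, zetaArg_eq hl hexp hreal hT hT', N₀]
    simp only [Θ]
    field_simp
    ring
  have hbound : |Θ t - L t| ≤ 1 / (150 * t) := abs_theta_sub_L_le hl hexp hreal ht
  by_cases hord : t ∈ ordinates
  · have hΘ : ContinuousAt Θ t := by
      have hopen : IsOpen {z : ℂ | 0 < z.re} := isOpen_lt continuous_const Complex.continuous_re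
      have h1 : ContinuousAt l (1 / 4 + t / 2 * Complex.I) := by
        refine hl.continuousAt (hopen.mem_nhds ?_)
        have : (1 / 4 + t / 2 * Complex.I : ℂ) = ((1 / 4 : ℝ) : ℂ) + ((t / 2 : ℝ) : ℂ) * Complex.I := by
          push_cast; ring
        rw [this]
        simp
      have h2 : ContinuousAt (fun T : ℝ => l (1 / 4 + T / 2 * Complex.I)) t :=
        ContinuousAt.comp (f := fun T : ℝ => (1 / 4 + T / 2 * Complex.I : ℂ)) h1 (by fun_prop)
      exact ((h2.sub (by fun_prop)).const_mul _).add_const 1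
    obtain ⟨c, hc⟩ := exists_eventually_symmMean_N₀_eq ht0
    have hN : Filter.Tendsto (symmMean N₀ t) (nhdsWithin 0 {0}ᶜ) (nhds c) :=
      tendsto_const_nhds.congr' (hc.mono fun _ h => h.symm)
    -- Both N₀ and S₀ jump at t, but away from ordinates they differ by the continuous Θ, whose
    -- symmetric mean tends to Θ(t).
    have hS : Filter.Tendsto (symmMean S₀ t) (nhdsWithin 0 {0}ᶜ) (nhds (c - Θ t)) := by
      refine (hN.sub (tendsto_symmMean hΘ)).congr' ?_
      obtain ⟨η, hη, hηt, hno⟩ := exists_forall_notMem_ordinates ht0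
      have h1 : ∀ᶠ δ in nhdsWithin (0 : ℝ) {0}ᶜ, |δ| < η :=
        mem_nhdsWithin_of_mem_nhds
          ((isOpen_lt continuous_abs continuous_const).mem_nhds (by simpa using hη))
      filter_upwards [h1, self_mem_nhdsWithin] with δ hδ h0
      have h0' : δ ≠ 0 := h0
      have hδ' := abs_lt.mp hδ
      rw [symmMean, symmMean, symmMean,
        hmain (t - δ) (by linarith) (hno _ (by simpa using h0') (by simpa using hδ)),
        hmain (t + δ) (by linarith) (hno _ (by simpa using h0') (by simpa using hδ))]
      ring
    have hNt : N t = c := by rw [N, if_pos hord]; exact hN.limUnder_eq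
    have hSt : S t = c - Θ t := by rw [S, if_pos hord]; exact hS.limUnder_eq
    refine ⟨fun _ => ⟨by rwa [hNt], by rwa [hSt]⟩, ?_⟩
    rw [Q, hNt, hSt, show c - L t - (c - Θ t) = Θ t - L t by ring]
    exact hbound
  · refine ⟨fun h => absurd h hord, ?_⟩
    rw [Q, N, S, if_neg hord, if_neg hord, hmain t ht0 hord,
      show N₀ t - L t - (N₀ t - Θ t) = Θ t - L t by ring]
    exact hbound
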